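/- Let $0<b\le\infty$ and let $q$ be real-valued with $q\in L^1((0,c))$ for all finite $c\le b$. Solutions of $-u''+qu=zu$ on $[0,b)$ are functions $u$ with $u,u'$ locally absolutely continuous on $[0,b)$ that satisfy the equation almost everywhere. One of the following boundary conditions is fixed at $b$: (i) $b<\infty$: $u'(b_-)+hu(b_-)=0$ for some $h\in\mathbb R$, or $u(b_-)=0$ ("$h=\infty$"); (ii) $b=\infty$ and the equation is limit point at $\infty$ (for each $z$ with $\operatorname{Im}z>0$ there is, up to a constant factor, exactly one nonzero solution that is $L^2$ at $\infty$): $u$ is $L^2$ at $\infty$; (iii) $b=\infty$ and the equation is limit circle at $\infty$ (for each $z$ with $\operatorname{Im}z>0$ all solutions are $L^2$ at $\infty$): $\lim_{x\to\infty}[u_0(x)u'(x)-u_0'(x)u(x)]=0$, where $u_0$ is a fixed nonzero solution for $z=i$ which defines a self-adjoint boundary condition, i.e. $\lim_{x\to\infty}[\overline{u_0(x)}u_0'(x)-\overline{u_0'(x)}u_0(x)]=0$. For $\operatorname{Im}z>0$ the Weyl–Titchmarsh function is $m(z,x)=u'(x,z)/u(x,z)$, where $u(\cdot,z)$ is a nonzero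 solution satisfying the boundary condition at $b$. Theorem. Let $\varepsilon,\delta,K_0>0$ and $\eta\in\mathbb R$. There is a constant $C$, depending only on $\varepsilon,\delta,K_0$ and $\eta$, such that the following holds. Let $a\ge 0$, let $q$, $b$ and a boundary condition be as above with $a+\delta\le b$ (in particular $q\in L^1((0,a+\delta))$), and suppose that $$\sup_{0\le x\le a}\int_x^{x+\delta}|q(y)|\,dy\le\eta .$$ Then for all $\kappa\in\mathbb C$ with $\arg\kappa\in(-\frac{\pi}{2}+\varepsilon,-\varepsilon)$ and $|\kappa|\ge K_0$, every nonzero solution $u$ for $z=-\kappa^2$ satisfying the boundary condition at $b$, and all $x\in[0,a]$, one has $u(x)\neq0$ and $$|m(-\kappa^2,x)+\kappa|\le C .$$ -/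

import Mathlib

open MeasureTheory Set Filter Topology

/-- `u` solves `-u'' + q u = z u` on `[0, b)` (`b` finite or `⊤`), with derivative `du = u'`:
`u` is differentiable (one-sidedly at `0`) with `u' = du`, and `du` is the indefinite integral of
`(q - z) u`, that is, `u'` is locally absolutely continuous on `[0, b)` and the equation holds
almost everywhere.  Used for `q` that is integrable on `(0, c)` for all finite `c < b`. -/
structure IsSchrodingerSolution (q : ℝ → ℝ) (b : EReal) (z : ℂ) (u du : ℝ → ℂ) : Prop where
  hasDeriv : ∀ x : ℝ, 0 ≤ x → (x : EReal) < b → HasDerivWithinAt u (du x) (Ici 0) x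
  equation : ∀ x : ℝ, 0 ≤ x → (x : EReal) < b →
    du x = du 0 + ∫ t in (0 : ℝ)..x, ((q t : ℂ) - z) * u t

/-- `u` does not vanish identically on `[0, b)`. -/
def IsNontrivialOn (b : EReal) (u : ℝ → ℂ) : Prop :=
  ∃ x : ℝ, 0 ≤ x ∧ (x : EReal) < b ∧ u x ≠ 0

/-- Square integrability on `(0, ∞)`; for a solution on `[0, ∞)`, which is continuous there, this is
the same as being `L²` at infinity. -/
def IsSquareIntegrable (u : ℝ → ℂ) : Prop :=
  IntegrableOn (fun x => ‖u x‖ ^ 2) (Ioi 0)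

/-- The limit point case at infinity: for every `z` in the upper half-plane there is, up to a
multiplicative constant, exactly one nonzero solution that is `L²` at infinity. -/
def IsLimitPoint (q : ℝ → ℝ) : Prop :=
  ∀ z : ℂ, 0 < z.im → ∃ u du : ℝ → ℂ,
    IsSchrodingerSolution q ⊤ z u du ∧ IsNontrivialOn ⊤ u ∧ IsSquareIntegrable u ∧
    ∀ w dw : ℝ → ℂ, IsSchrodingerSolution q ⊤ z w dw → IsSquareIntegrable w →
      ∃ c : ℂ, ∀ x : ℝ, 0 ≤ x → w x = c * u x

/-- The limit circle case at infinity: for every `z` in the upper half-plane all solutions are `L²`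
at infinity. -/
def IsLimitCircle (q : ℝ → ℝ) : Prop :=
  ∀ z : ℂ, 0 < z.im → ∀ u du : ℝ → ℂ,
    IsSchrodingerSolution q ⊤ z u du → IsSquareIntegrable u

/-- The right endpoint of the half-line problem together with the boundary condition there. -/
inductive RightEnd where
  /-- `b < ∞` with `u'(b-) + h u(b-) = 0`, `h` real. -/
  | robin (b h : ℝ)
  /-- `b < ∞` with `u(b-) = 0` (the case `h = ∞`). -/
  | dirichlet (b : ℝ)
  /-- `b = ∞`, limit point case: no boundary condition but square integrability. -/
  | limitPoint
  /-- `b = ∞`, limit circle case, with the boundary condition given by a solution `u₀`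
  (with derivative `du₀`) of the equation with `z = i`. -/
  | limitCircle (u₀ du₀ : ℝ → ℂ)

namespace RightEnd

/-- The right endpoint `b ≤ ∞`. -/
noncomputable def point : RightEnd → EReal
  | robin b _ => (b : EReal)
  | dirichlet b => (b : EReal)
  | limitPoint => ⊤
  | limitCircle _ _ => ⊤

/-- The assumptions on the potential `q` (and on `u₀`) in the respective case.  In the limit circle
case the last conjunct says that `u₀` defines a self-adjoint boundary condition at infinity, i.e.
that the Wronskian of `u₀` and its complex conjugate tends to zero. -/
def Admissible (q : ℝ → ℝ) : RightEnd → Prop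
  | robin b _ => IntegrableOn q (Ioo 0 b)
  | dirichlet b => IntegrableOn q (Ioo 0 b)
  | limitPoint => (∀ c : ℝ, IntegrableOn q (Ioo 0 c)) ∧ IsLimitPoint q
  | limitCircle u₀ du₀ => (∀ c : ℝ, IntegrableOn q (Ioo 0 c)) ∧ IsLimitCircle q ∧
      IsSchrodingerSolution q ⊤ Complex.I u₀ du₀ ∧ IsNontrivialOn ⊤ u₀ ∧
      Tendsto (fun x => star (u₀ x) * du₀ x - star (du₀ x) * u₀ x) atTop (𝓝 0)

/-- The boundary condition at the right endpoint for a solution `u` with derivative `du`. -/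
def Condition (u du : ℝ → ℂ) : RightEnd → Prop
  | robin b h => Tendsto (fun x => du x + (h : ℂ) * u x) (𝓝[<] b) (𝓝 0)
  | dirichlet b => Tendsto u (𝓝[<] b) (𝓝 0)
  | limitPoint => IsSquareIntegrable u
  | limitCircle u₀ du₀ => Tendsto (fun x => u₀ x * du x - du₀ x * u x) atTop (𝓝 0)

end RightEnd

/-- `u` (with derivative `du`) is a nonzero solution of `-u'' + q u = z u` on `[0, b)` that satisfies
the boundary condition at the right endpoint.  The Weyl-Titchmarsh `m`-function is
`m(z, x) = u'(x) / u(x) = du x / u x` for any such `u`. -/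
structure IsWeylSolution (q : ℝ → ℝ) (B : RightEnd) (z : ℂ) (u du : ℝ → ℂ) : Prop where
  solution : IsSchrodingerSolution q B.point z u du
  nontrivial : IsNontrivialOn B.point u
  condition : B.Condition u du

/-!
For `Im z > 0` the current `Im (ū u')` of a solution `u` is nonincreasing, with derivative
`-Im z |u|²`, and every boundary condition at `b` makes it nonnegative on `[0, b)`. At a finite `b`
it vanishes at `b`. In the limit point case the points of the nested Weyl disks give a solution with
nonnegative current, which is therefore square integrable and hence proportional to `u`. In the
limit circle case all Wronskians of solutions are bounded, so by the Plücker relation the boundary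
condition at `z = i` passes from `u₀` to its conjugate and from there to the pair `(ū, u)`; thus the
current tends to `0` at infinity.

A nonnegative current bounds `m = u' / u`: a large `u'(x)` relative to `u(x)` would make `|u|` grow
linearly on a short interval, and the mass `∫ |u|²` would exceed what the current at `x` can
balance. This also shows that `u` has no zeros, and it suffices for bounded `|κ|`. For large `|κ|`
the Cayley transform `R = (m + κ) / (m - κ)` satisfies the Riccati equation
`R' = 2 κ R - q (R - 1)² / (2 κ)`. Since `Im m ≥ 0` and `κ` lies in a sector of the fourth quadrant,
`R` is bounded, and as `Re κ > 0`, integrating backwards over `[x, x + δ]` yields `R = O(1 / |κ|)`,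
that is, `m + κ = O(1)`.
-/

/-! ### Absolutely continuous functions with integrable derivative -/

/-- `F` is absolutely continuous on the segment between `a` and `b`, and `f` is an integrable
representative of its almost everywhere derivative there. -/
structure HasACDeriv {E : Type*} [NormedAddCommGroup E] [NormedSpace ℝ E] (F f : ℝ → E)
    (a b : ℝ) : Prop where
  ac : AbsolutelyContinuousOnInterval F a b
  integrable : IntervalIntegrable f volume a b
  ae_hasDerivAt : ∀ᵐ x, x ∈ uIcc a b → HasDerivAt F (f x) x

theorem absolutelyContinuousOnInterval_of_dist_le {X Y : Type*} [PseudoMetricSpace X]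
    [PseudoMetricSpace Y] {f : ℝ → X} {g : ℝ → Y} {a b K : ℝ}
    (hf : AbsolutelyContinuousOnInterval f a b)
    (h : ∀ x ∈ uIcc a b, ∀ y ∈ uIcc a b, dist (g x) (g y) ≤ K * dist (f x) (f y)) :
    AbsolutelyContinuousOnInterval g a b := by
  have hlim := Tendsto.const_mul K hf
  rw [mul_zero] at hlim
  refine squeeze_zero' (Eventually.of_forall fun t => Finset.sum_nonneg fun i _ => dist_nonneg) ?_
    hlim
  refine eventually_inf_principal.2 (Eventually.of_forall fun t ht => ?_)
  rw [Finset.mul_sum]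
  exact Finset.sum_le_sum fun i hi => h _ (ht.1 i hi).1 _ (ht.1 i hi).2

namespace HasACDeriv

section Basic

variable {E E' : Type*} [NormedAddCommGroup E] [NormedSpace ℝ E] [NormedAddCommGroup E']
  [NormedSpace ℝ E'] {F G f g : ℝ → E} {a b c d : ℝ}

theorem continuousOn (hF : HasACDeriv F f a b) : ContinuousOn F (uIcc a b) := hF.ac.continuousOn

theorem mono (hF : HasACDeriv F f a b) (h : uIcc c d ⊆ uIcc a b) : HasACDeriv F f c d :=
  ⟨hF.ac.mono h, hF.integrable.mono_set h, hF.ae_hasDerivAt.mono fun _ hx hx' => hx (h hx')⟩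

theorem congr_deriv (hF : HasACDeriv F f a b) (h : EqOn f g (uIcc a b)) : HasACDeriv F g a b := by
  refine ⟨hF.ac, hF.integrable.congr fun x hx => h (uIoc_subset_uIcc hx), ?_⟩
  filter_upwards [hF.ae_hasDerivAt] with x hFx hx
  exact h hx ▸ hFx hx

theorem congr (hF : HasACDeriv F f a b) (h : EqOn F G (uIcc a b)) : HasACDeriv G f a b := by
  refine ⟨absolutelyContinuousOnInterval_of_dist_le (K := 1) hF.ac fun x hx y hy => ?_,
    hF.integrable, ?_⟩
  · rw [one_mul, h hx, h hy]
  · have ha : ∀ᵐ x : ℝ, x ≠ min a b := by simp [ae_iff, measure_singleton]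
    have hb : ∀ᵐ x : ℝ, x ≠ max a b := by simp [ae_iff, measure_singleton]
    filter_upwards [hF.ae_hasDerivAt, ha, hb] with x hFx hxa hxb hx
    refine (hFx hx).congr_of_eventuallyEq (h.symm.eventuallyEq_of_mem (Icc_mem_nhds ?_ ?_))
    · exact lt_of_le_of_ne hx.1 hxa.symm
    · exact lt_of_le_of_ne hx.2 hxb

theorem add (hF : HasACDeriv F f a b) (hG : HasACDeriv G g a b) :
    HasACDeriv (fun x => F x + G x) (fun x => f x + g x) a b := by
  refine ⟨hF.ac.fun_add hG.ac, hF.integrable.add hG.integrable, ?_⟩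
  filter_upwards [hF.ae_hasDerivAt, hG.ae_hasDerivAt] with x hFx hGx hx
  exact (hFx hx).add (hGx hx)

theorem const_add (hF : HasACDeriv F f a b) (y : E) : HasACDeriv (fun x => y + F x) f a b := by
  refine ⟨absolutelyContinuousOnInterval_of_dist_le (K := 1) hF.ac fun x _ y _ => ?_,
    hF.integrable, hF.ae_hasDerivAt.mono fun x hx hx' => (hx hx').const_add y⟩
  rw [one_mul, dist_add_left]

theorem clm_comp (hF : HasACDeriv F f a b) (L : E →L[ℝ] E') :
    HasACDeriv (fun x => L (F x)) (fun x => L (f x)) a b := by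
  refine ⟨absolutelyContinuousOnInterval_of_dist_le (K := ‖L‖) hF.ac fun x _ y _ => ?_,
    ⟨L.integrable_comp hF.integrable.1, L.integrable_comp hF.integrable.2⟩,
    hF.ae_hasDerivAt.mono fun x hx hx' => L.hasFDerivAt.comp_hasDerivAt x (hx hx')⟩
  rw [dist_eq_norm, dist_eq_norm, ← map_sub]
  exact L.le_opNorm _

end Basic

section Integral

variable {E : Type*} [NormedAddCommGroup E] [NormedSpace ℝ E] [CompleteSpace E] {F f : ℝ → E}
  {a b : ℝ}

theorem integral_left (hf : IntervalIntegrable f volume a b) :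
    HasACDeriv (fun x => ∫ t in a..x, f t) f a b := by
  have hsub : ∀ x ∈ uIcc a b, IntervalIntegrable f volume a x := fun x hx =>
    hf.mono_set (uIcc_subset_uIcc_left hx)
  refine ⟨absolutelyContinuousOnInterval_of_dist_le (K := 1)
    (hf.norm.absolutelyContinuousOnInterval_intervalIntegral (c := a) left_mem_uIcc)
    fun x hx y hy => ?_, hf,
    hf.ae_hasDerivAt_integral.mono fun x hx hx' => hx hx' a left_mem_uIcc⟩
  rw [one_mul, dist_eq_norm, dist_eq_norm,
    intervalIntegral.integral_interval_sub_left (hsub x hx) (hsub y hy),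
    intervalIntegral.integral_interval_sub_left (hsub x hx).norm (hsub y hy).norm, Real.norm_eq_abs]
  exact intervalIntegral.norm_integral_le_abs_integral_norm

theorem of_eq_integral (hf : IntervalIntegrable f volume a b)
    (hF : ∀ x ∈ uIcc a b, F x = F a + ∫ t in a..x, f t) : HasACDeriv F f a b :=
  ((integral_left hf).const_add (F a)).congr fun x hx => (hF x hx).symm

theorem integral_eq (hF : HasACDeriv F f a b) : ∫ x in a..b, f x = F b - F a := by
  have hI := integral_left hF.integrable
  obtain ⟨C, hC⟩ := (hF.ac.sub hI.ac).const_of_ae_hasDerivAt_zero <| by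
    filter_upwards [hF.ae_hasDerivAt, hI.ae_hasDerivAt] with x hFx hIx hx
    simpa using (hFx hx).sub (hIx hx)
  have hab := (hC b right_mem_uIcc).trans (hC a left_mem_uIcc).symm
  simp only [Pi.sub_apply, intervalIntegral.integral_same, sub_zero] at hab
  rw [← hab, sub_sub_cancel]

theorem of_hasDerivAt (hF : ∀ x, HasDerivAt F (f x) x) (hf : Continuous f) :
    HasACDeriv F f a b := by
  refine of_eq_integral (hf.intervalIntegrable _ _) fun x _ => ?_
  rw [intervalIntegral.integral_eq_sub_of_hasDerivAt (fun t _ => hF t) (hf.intervalIntegrable _ _),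
    add_sub_cancel]

end Integral

section Mul

variable {𝕜 : Type*} [RCLike 𝕜] {F G f g : ℝ → 𝕜} {a b : ℝ}

theorem mul (hF : HasACDeriv F f a b) (hG : HasACDeriv G g a b) :
    HasACDeriv (fun x => F x * G x) (fun x => f x * G x + F x * g x) a b := by
  refine ⟨hF.ac.fun_smul hG.ac, (hF.integrable.mul_continuousOn hG.continuousOn).add
    (hG.integrable.continuousOn_mul hF.continuousOn), ?_⟩
  filter_upwards [hF.ae_hasDerivAt, hG.ae_hasDerivAt] with x hFx hGx hx
  exact (hFx hx).mul (hGx hx)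

theorem const_mul (hF : HasACDeriv F f a b) (c : 𝕜) :
    HasACDeriv (fun x => c * F x) (fun x => c * f x) a b :=
  hF.clm_comp (ContinuousLinearMap.mul ℝ 𝕜 c)

theorem pow (hF : HasACDeriv F f a b) (n : ℕ) :
    HasACDeriv (fun x => F x ^ (n + 1)) (fun x => (n + 1) * (F x ^ n * f x)) a b := by
  induction n with
  | zero => simpa using hF
  | succ n ih =>
    refine ((hF.mul ih).congr_deriv fun x _ => ?_).congr fun x _ => (pow_succ' (F x) (n + 1)).symm
    push_cast
    ring

theorem inv (hF : HasACDeriv F f a b) (hF₀ : ∀ x ∈ uIcc a b, F x ≠ 0) :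
    HasACDeriv (fun x => (F x)⁻¹) (fun x => -f x / F x ^ 2) a b := by
  have hinv : ContinuousOn (fun x => (F x)⁻¹) (uIcc a b) := hF.continuousOn.inv₀ hF₀
  obtain ⟨C, hC⟩ := isCompact_uIcc.exists_bound_of_continuousOn hinv
  refine ⟨absolutelyContinuousOnInterval_of_dist_le (K := C * C) hF.ac fun x hx y hy => ?_, ?_,
    hF.ae_hasDerivAt.mono fun x hx hx' => (hx hx').inv (hF₀ x hx')⟩
  · rw [dist_eq_norm, dist_eq_norm, inv_sub_inv (hF₀ x hx) (hF₀ y hy), div_eq_mul_inv, mul_inv,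
      norm_mul, norm_mul, norm_sub_rev, mul_comm]
    exact mul_le_mul_of_nonneg_right (mul_le_mul (hC x hx) (hC y hy) (norm_nonneg _)
      ((norm_nonneg _).trans (hC x hx))) (norm_nonneg _)
  · refine (hF.integrable.neg.mul_continuousOn (hinv.mul hinv)).congr fun x _ => ?_
    simp only [Pi.neg_apply, Pi.mul_apply]
    rw [div_eq_mul_inv, pow_two, mul_inv]

end Mul

end HasACDeriv

/-! ### Linear equations with integrable coefficients -/

section LinearODE

variable {E : Type*} [NormedAddCommGroup E] [NormedSpace ℝ E] {A : ℝ → E →L[ℝ] E} {a c : ℝ}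

theorem intervalIntegrable_clm_apply {y : ℝ → E} (hA : IntervalIntegrable A volume a c)
    (hy : ContinuousOn y (uIcc a c)) : IntervalIntegrable (fun t => A t (y t)) volume a c := by
  obtain ⟨C, hC⟩ := isCompact_uIcc.exists_bound_of_continuousOn hy
  refine (hA.norm.mul_const C).mono_fun ?_ ?_
  · exact (ContinuousLinearMap.apply ℝ E).aestronglyMeasurable_comp₂
      ((hy.mono uIoc_subset_uIcc).aestronglyMeasurable measurableSet_uIoc)
      hA.def'.1
  · filter_upwards [ae_restrict_mem measurableSet_uIoc] with t ht
    rw [norm_mul, norm_norm]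
    exact (A t).le_of_opNorm_le_of_le le_rfl ((hC t (uIoc_subset_uIcc ht)).trans (le_abs_self C))

/-- The terms of the Neumann series of the initial value problem `Y' = A Y`, `Y a = y₀`, that is,
of the solution of `Y = y₀ + ∫ A Y` by Picard iteration. -/
noncomputable def neumannTerm (A : ℝ → E →L[ℝ] E) (a : ℝ) (y₀ : E) : ℕ → ℝ → E
  | 0 => fun _ => y₀
  | n + 1 => fun x => ∫ t in a..x, A t (neumannTerm A a y₀ n t)

variable [CompleteSpace E]

theorem continuousOn_neumannTerm (hA : IntervalIntegrable A volume a c) (y₀ : E) (n : ℕ) :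
    ContinuousOn (neumannTerm A a y₀ n) (uIcc a c) := by
  induction n with
  | zero => exact continuousOn_const
  | succ n ih => exact (HasACDeriv.integral_left (intervalIntegrable_clm_apply hA ih)).continuousOn

theorem integral_mul_primitive_pow {p : ℝ → ℝ} (hp : IntervalIntegrable p volume a c) (n : ℕ) :
    ∫ t in a..c, p t * (∫ s in a..t, p s) ^ n = (∫ t in a..c, p t) ^ (n + 1) / (n + 1) := by
  have hpow := ((HasACDeriv.integral_left hp).pow n).integral_eq
  rw [intervalIntegral.integral_const_mul, intervalIntegral.integral_same,
    zero_pow n.succ_ne_zero, sub_zero] at hpow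
  rw [eq_div_iff (by positivity), ← hpow, mul_comm]
  simp only [mul_comm]

theorem norm_neumannTerm_le (hac : a ≤ c) (hA : IntervalIntegrable A volume a c) (y₀ : E) (n : ℕ) :
    ‖neumannTerm A a y₀ n c‖ ≤ ‖y₀‖ * ((∫ t in a..c, ‖A t‖) ^ n / n.factorial) := by
  induction n generalizing c with
  | zero => simp [neumannTerm]
  | succ n ih =>
    have hle : ∀ t ∈ Icc a c, ‖A t (neumannTerm A a y₀ n t)‖ ≤
        ‖y₀‖ / n.factorial * (‖A t‖ * (∫ s in a..t, ‖A s‖) ^ n) := fun t ht => by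
      have hAt := hA.mono_set (uIcc_subset_uIcc_left (uIcc_of_le hac ▸ ht))
      exact ((A t).le_of_opNorm_le_of_le le_rfl (ih ht.1 hAt)).trans_eq (by ring)
    have hint : IntervalIntegrable (fun t => ‖A t‖ * (∫ s in a..t, ‖A s‖) ^ n) volume a c :=
      hA.norm.mul_continuousOn ((HasACDeriv.integral_left hA.norm).continuousOn.pow n)
    calc ‖neumannTerm A a y₀ (n + 1) c‖
        ≤ ∫ t in a..c, ‖A t (neumannTerm A a y₀ n t)‖ :=
          intervalIntegral.norm_integral_le_integral_norm hac
      _ ≤ ∫ t in a..c, ‖y₀‖ / n.factorial * (‖A t‖ * (∫ s in a..t, ‖A s‖) ^ n) :=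
          intervalIntegral.integral_mono_on hac
            (intervalIntegrable_clm_apply hA (continuousOn_neumannTerm hA y₀ n)).norm
            (hint.const_mul _) hle
      _ = ‖y₀‖ * ((∫ t in a..c, ‖A t‖) ^ (n + 1) / (n + 1).factorial) := by
          rw [intervalIntegral.integral_const_mul, integral_mul_primitive_pow hA.norm,
            Nat.factorial_succ]
          push_cast
          field_simp

theorem exists_summable_bound_neumannTerm (hA : IntervalIntegrable A volume a c) (y₀ : E) :
    ∃ S : ℕ → ℝ, Summable S ∧ ∀ n, ∀ x ∈ Icc a c, ‖neumannTerm A a y₀ n x‖ ≤ S n := by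
  refine ⟨fun n => ‖y₀‖ * ((∫ t in a..c, ‖A t‖) ^ n / n.factorial),
    (Real.summable_pow_div_factorial _).mul_left _, fun n x hx => ?_⟩
  have hnonneg : 0 ≤ ∫ t in a..x, ‖A t‖ :=
    intervalIntegral.integral_nonneg hx.1 fun _ _ => norm_nonneg _
  have hmono : ∫ t in a..x, ‖A t‖ ≤ ∫ t in a..c, ‖A t‖ :=
    intervalIntegral.integral_mono_interval le_rfl hx.1 hx.2
      (Eventually.of_forall fun _ => norm_nonneg _) hA.norm
  calc ‖neumannTerm A a y₀ n x‖ ≤ ‖y₀‖ * ((∫ t in a..x, ‖A t‖) ^ n / n.factorial) :=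
        norm_neumannTerm_le hx.1 (hA.mono_set (uIcc_subset_uIcc_left (Icc_subset_uIcc hx))) y₀ n
    _ ≤ ‖y₀‖ * ((∫ t in a..c, ‖A t‖) ^ n / n.factorial) := by gcongr

theorem tsum_neumannTerm_eq (hac : a ≤ c) (hA : IntervalIntegrable A volume a c) (y₀ : E) :
    ∑' n, neumannTerm A a y₀ n c = y₀ + ∫ t in a..c, A t (∑' n, neumannTerm A a y₀ n t) := by
  obtain ⟨S, hS, hle⟩ := exists_summable_bound_neumannTerm hA y₀
  have hsum : ∀ t ∈ Icc a c, Summable fun n => neumannTerm A a y₀ n t := fun t ht =>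
    hS.of_norm_bounded fun n => hle n t ht
  have hIcc : ∀ t ∈ uIoc a c, t ∈ Icc a c := fun t ht => uIcc_of_le hac ▸ uIoc_subset_uIcc ht
  have hswap : HasSum (fun n => ∫ t in a..c, A t (neumannTerm A a y₀ n t))
      (∫ t in a..c, A t (∑' n, neumannTerm A a y₀ n t)) := by
    refine intervalIntegral.hasSum_integral_of_dominated_convergence (fun n t => ‖A t‖ * S n)
      (fun n => ?_) (fun n => .of_forall fun t ht => ?_) (.of_forall fun t _ => hS.mul_left _) ?_
      (.of_forall fun t ht => (A t).hasSum (hsum t (hIcc t ht)).hasSum)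
    · exact (intervalIntegrable_clm_apply hA (continuousOn_neumannTerm hA y₀ n)).def'.1
    · exact (A t).le_of_opNorm_le_of_le le_rfl (hle n t (hIcc t ht))
    · simpa only [tsum_mul_left] using hA.norm.mul_const _
  rw [(hsum c (right_mem_Icc.2 hac)).tsum_eq_zero_add, ← hswap.tsum_eq]
  rfl

theorem exists_hasACDeriv_linear (A : ℝ → E →L[ℝ] E) (a : ℝ) (y₀ : E) :
    ∃ Y : ℝ → E, Y a = y₀ ∧ ∀ c, a ≤ c → IntervalIntegrable A volume a c →
      HasACDeriv Y (fun t => A t (Y t)) a c := by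
  have hinit : ∑' n, neumannTerm A a y₀ n a = y₀ := by
    simpa using tsum_neumannTerm_eq le_rfl (IntervalIntegrable.refl (f := A)) y₀
  refine ⟨fun x => ∑' n, neumannTerm A a y₀ n x, hinit, fun c hac hA => ?_⟩
  obtain ⟨S, hS, hle⟩ := exists_summable_bound_neumannTerm hA y₀
  have hcont : ContinuousOn (fun x => ∑' n, neumannTerm A a y₀ n x) (uIcc a c) :=
    continuousOn_tsum (continuousOn_neumannTerm hA y₀) hS fun n x hx =>
      hle n x (uIcc_of_le hac ▸ hx)
  refine .of_eq_integral (intervalIntegrable_clm_apply hA hcont) fun x hx => ?_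
  rw [hinit]
  exact tsum_neumannTerm_eq (uIcc_of_le hac ▸ hx).1 (hA.mono_set (uIcc_subset_uIcc_left hx)) y₀

end LinearODE

/-! ### Wronskian and current -/

/-- `u` is a Carathéodory solution of `u'' = p u` on the segment between `a` and `b`, with
derivative `du`. The equation `-u'' + q u = z u` is the case `p = q - z`. -/
structure IsSolutionOn (p u du : ℝ → ℂ) (a b : ℝ) : Prop where
  coeff : IntervalIntegrable p volume a b
  hasACDeriv : HasACDeriv u du a b
  hasACDeriv_deriv : HasACDeriv du (fun t => p t * u t) a b

/-- The Wronskian `u v' - u' v`. -/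
def wronskian (u du v dv : ℝ → ℂ) (x : ℝ) : ℂ := u x * dv x - du x * v x

/-- The imaginary part of `ū u'`, the quantum mechanical probability current. Where `u` does not
vanish it has the sign of the imaginary part of `u' / u`. -/
noncomputable def flux (u du : ℝ → ℂ) (x : ℝ) : ℝ := (star (u x) * du x).im

theorem wronskian_star_self (u du : ℝ → ℂ) (x : ℝ) :
    wronskian (fun t => star (u t)) (fun t => star (du t)) u du x =
      2 * Complex.I * flux u du x := by
  simp only [wronskian, flux]
  apply Complex.ext <;> simp [Complex.mul_re, Complex.mul_im] <;> ring

namespace IsSolutionOn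

variable {p r u du v dv : ℝ → ℂ} {a b c d : ℝ}

theorem mono (h : IsSolutionOn p u du a b) (hc : c ∈ Icc a b) (hd : d ∈ Icc a b) :
    IsSolutionOn p u du c d := by
  have hcd : uIcc c d ⊆ uIcc a b := uIcc_subset_uIcc (Icc_subset_uIcc hc) (Icc_subset_uIcc hd)
  exact ⟨h.coeff.mono_set hcd, h.hasACDeriv.mono hcd, h.hasACDeriv_deriv.mono hcd⟩

theorem mono_left (h : IsSolutionOn p u du a b) (hc : c ∈ Icc a b) : IsSolutionOn p u du a c :=
  h.mono (left_mem_Icc.2 (hc.1.trans hc.2)) hc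

theorem mono_right (h : IsSolutionOn p u du a b) (hc : c ∈ Icc a b) : IsSolutionOn p u du c b :=
  h.mono hc (right_mem_Icc.2 (hc.1.trans hc.2))

theorem integral_norm_coeff_mono (h : IsSolutionOn p u du a b) (hac : a ≤ c) (hcd : c ≤ d)
    (hdb : d ≤ b) : ∫ t in c..d, ‖p t‖ ≤ ∫ t in a..b, ‖p t‖ :=
  intervalIntegral.integral_mono_interval hac hcd hdb (.of_forall fun _ => norm_nonneg _)
    h.coeff.norm

theorem add_const_mul (hu : IsSolutionOn p u du a b) (hv : IsSolutionOn p v dv a b) (k : ℂ) :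
    IsSolutionOn p (fun t => u t + k * v t) (fun t => du t + k * dv t) a b :=
  ⟨hu.coeff, hu.hasACDeriv.add (hv.hasACDeriv.const_mul k),
    (hu.hasACDeriv_deriv.add (hv.hasACDeriv_deriv.const_mul k)).congr_deriv fun t _ => by ring⟩

theorem conj (h : IsSolutionOn p u du a b) :
    IsSolutionOn (fun t => star (p t)) (fun t => star (u t)) (fun t => star (du t)) a b := by
  let σ : ℂ →L[ℝ] ℂ := Complex.conjCLE.toContinuousLinearMap
  exact ⟨⟨σ.integrable_comp h.coeff.1, σ.integrable_comp h.coeff.2⟩, h.hasACDeriv.clm_comp σ,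
    (h.hasACDeriv_deriv.clm_comp σ).congr_deriv fun t _ => star_mul' (p t) (u t)⟩

theorem wronskian_sub_eq_integral (hu : IsSolutionOn p u du a b) (hv : IsSolutionOn r v dv a b) :
    wronskian u du v dv b - wronskian u du v dv a = ∫ t in a..b, (r t - p t) * (u t * v t) := by
  have hW := (hu.hasACDeriv.mul hv.hasACDeriv_deriv).add
    ((hu.hasACDeriv_deriv.mul hv.hasACDeriv).const_mul (-1))
  rw [(hW.congr_deriv (g := fun t => (r t - p t) * (u t * v t)) fun t _ => by ring).integral_eq]
  simp only [wronskian]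
  ring

theorem wronskian_eq (hu : IsSolutionOn p u du a b) (hv : IsSolutionOn p v dv a b) :
    wronskian u du v dv b = wronskian u du v dv a := by
  simpa [sub_eq_zero] using hu.wronskian_sub_eq_integral hv

theorem hasACDeriv_flux (h : IsSolutionOn p u du a b) :
    HasACDeriv (flux u du) (fun t => (p t).im * ‖u t‖ ^ 2) a b := by
  refine ((h.conj.hasACDeriv.mul h.hasACDeriv_deriv).clm_comp Complex.imCLM).congr_deriv
    fun t _ => ?_
  simp only [Complex.imCLM_apply, ← Complex.normSq_eq_norm_sq, Complex.normSq_apply,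
    Complex.star_def, Complex.add_im, Complex.mul_im, Complex.mul_re, Complex.conj_re,
    Complex.conj_im]
  ring

theorem integral_im_mul_norm_sq (h : IsSolutionOn p u du a b) :
    ∫ t in a..b, (p t).im * ‖u t‖ ^ 2 = flux u du b - flux u du a :=
  h.hasACDeriv_flux.integral_eq

theorem flux_le (hab : a ≤ b) (h : IsSolutionOn p u du a b) (hp : ∀ t ∈ Icc a b, (p t).im ≤ 0) :
    flux u du b ≤ flux u du a := by
  rw [← sub_nonneg, ← neg_sub, ← h.integral_im_mul_norm_sq, ← intervalIntegral.integral_neg]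
  exact intervalIntegral.integral_nonneg hab fun t ht =>
    neg_nonneg.2 (mul_nonpos_of_nonpos_of_nonneg (hp t ht) (sq_nonneg _))

end IsSolutionOn

theorem exists_isSolutionOn (p : ℝ → ℂ) (a : ℝ) (α β : ℂ) :
    ∃ u du : ℝ → ℂ, u a = α ∧ du a = β ∧
      ∀ c, a ≤ c → IntervalIntegrable p volume a c → IsSolutionOn p u du a c := by
  let L := (ContinuousLinearMap.inl ℝ ℂ ℂ).comp (.snd ℝ ℂ ℂ)
  let M := (ContinuousLinearMap.inr ℝ ℂ ℂ).comp (.fst ℝ ℂ ℂ)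
  obtain ⟨Y, hYa, hY⟩ := exists_hasACDeriv_linear (fun t => L + p t • M) a (α, β)
  refine ⟨fun t => (Y t).1, fun t => (Y t).2, congrArg Prod.fst hYa, congrArg Prod.snd hYa,
    fun c hac hp => ?_⟩
  have hYc := hY c hac (intervalIntegrable_const.add ⟨hp.1.smul_const M, hp.2.smul_const M⟩)
  exact ⟨hp, by simpa [L, M] using hYc.clm_comp (.fst ℝ ℂ ℂ),
    by simpa [L, M] using hYc.clm_comp (.snd ℝ ℂ ℂ)⟩

namespace IsSolutionOn

variable {p u du v dv : ℝ → ℂ} {a b x y : ℝ}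

theorem eq_zero (h : IsSolutionOn p u du a b) (hx : x ∈ Icc a b) (hu : u x = 0) (hdu : du x = 0)
    (hy : y ∈ Icc a b) : u y = 0 ∧ du y = 0 := by
  have hab := hx.1.trans hx.2
  obtain ⟨θ, dθ, hθa, hdθa, hθ⟩ := exists_isSolutionOn p a 1 0
  obtain ⟨φ, dφ, hφa, hdφa, hφ⟩ := exists_isSolutionOn p a 0 1
  have hθ := hθ b hab h.coeff
  have hφ := hφ b hab h.coeff
  have hθφ := (hθ.mono_left hy).wronskian_eq (hφ.mono_left hy)
  have huθ := (h.mono hx hy).wronskian_eq (hθ.mono hx hy)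
  have huφ := (h.mono hx hy).wronskian_eq (hφ.mono hx hy)
  simp only [wronskian, hθa, hdθa, hφa, hdφa, hu, hdu, mul_one, mul_zero, zero_mul, sub_zero]
    at hθφ huθ huφ
  exact ⟨by linear_combination θ y * huφ - φ y * huθ - u y * hθφ,
    by linear_combination dθ y * huφ - dφ y * huθ - du y * hθφ⟩

theorem eqOn (hu : IsSolutionOn p u du a b) (hv : IsSolutionOn p v dv a b) (hx : x ∈ Icc a b)
    (huv : u x = v x) (hduv : du x = dv x) : EqOn u v (Icc a b) ∧ EqOn du dv (Icc a b) := by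
  have hzero : ∀ y ∈ Icc a b, u y + -1 * v y = 0 ∧ du y + -1 * dv y = 0 := fun y hy =>
    (hu.add_const_mul hv (-1)).eq_zero hx (by rw [huv]; ring) (by rw [hduv]; ring) hy
  exact ⟨fun y hy => by linear_combination (hzero y hy).1,
    fun y hy => by linear_combination (hzero y hy).2⟩

end IsSolutionOn

/-! ### Nonnegative current controls the logarithmic derivative -/

theorem flux_le_norm_mul_norm (u du : ℝ → ℂ) (x : ℝ) : flux u du x ≤ ‖u x‖ * ‖du x‖ :=
  (Complex.im_le_norm _).trans_eq (by rw [norm_mul, norm_star])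

namespace IsSolutionOn

variable {p u du : ℝ → ℂ} {a b M L θ : ℝ}

theorem norm_deriv_sub_le (h : IsSolutionOn p u du a b) (hab : a ≤ b)
    (hM : ∀ t ∈ Icc a b, ‖u t‖ ≤ M) : ‖du b - du a‖ ≤ M * ∫ t in a..b, ‖p t‖ := by
  rw [← h.hasACDeriv_deriv.integral_eq, ← intervalIntegral.integral_const_mul]
  refine (intervalIntegral.norm_integral_le_integral_norm hab).trans
    (intervalIntegral.integral_mono_on hab h.hasACDeriv_deriv.integrable.norm
      (h.coeff.norm.const_mul M) fun t ht => ?_)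
  rw [norm_mul, mul_comm]
  gcongr
  exact hM t ht

theorem norm_sub_sub_mul_deriv_le (h : IsSolutionOn p u du a b) (hab : a ≤ b)
    (hM : ∀ t ∈ Icc a b, ‖u t‖ ≤ M) :
    ‖u b - u a - (b - a) * du a‖ ≤ (b - a) * (M * ∫ t in a..b, ‖p t‖) := by
  have hM₀ : 0 ≤ M := (norm_nonneg _).trans (hM a (left_mem_Icc.2 hab))
  have hremainder : ∫ t in a..b, (du t - du a) = u b - u a - (b - a) * du a := by
    rw [intervalIntegral.integral_sub h.hasACDeriv.integrable intervalIntegrable_const,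
      h.hasACDeriv.integral_eq, intervalIntegral.integral_const, Complex.real_smul,
      Complex.ofReal_sub]
  rw [← hremainder, mul_comm, ← abs_of_nonneg (sub_nonneg.2 hab)]
  refine intervalIntegral.norm_integral_le_of_norm_le_const fun t ht => ?_
  rw [uIoc_of_le hab] at ht
  have hsub : Icc a t ⊆ Icc a b := Icc_subset_Icc_right ht.2
  calc ‖du t - du a‖ ≤ M * ∫ s in a..t, ‖p s‖ :=
        (h.mono_left ⟨ht.1.le, ht.2⟩).norm_deriv_sub_le ht.1.le fun s hs => hM s (hsub hs)
    _ ≤ M * ∫ s in a..b, ‖p s‖ := by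
        gcongr
        exact h.integral_norm_coeff_mono le_rfl ht.1.le ht.2

theorem norm_sub_sub_mul_deriv_le_third (h : IsSolutionOn p u du a b) (hab : a ≤ b)
    (hp : (b - a) * ∫ t in a..b, ‖p t‖ ≤ 1 / 4) {t : ℝ} (ht : t ∈ Icc a b) :
    ‖u t - u a - (t - a) * du a‖ ≤ (‖u a‖ + (b - a) * ‖du a‖) / 3 := by
  have hcont : ContinuousOn (fun t => ‖u t‖) (Icc a b) :=
    uIcc_of_le hab ▸ h.hasACDeriv.continuousOn.norm
  obtain ⟨m, hm, hmax⟩ := isCompact_Icc.exists_isMaxOn (nonempty_Icc.2 hab) hcont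
  have hquarter : ∀ t ∈ Icc a b, ‖u t - u a - (t - a) * du a‖ ≤ ‖u m‖ / 4 := fun t ht => by
    have hpt : (t - a) * ∫ s in a..t, ‖p s‖ ≤ (b - a) * ∫ s in a..b, ‖p s‖ := by
      gcongr
      · exact intervalIntegral.integral_nonneg ht.1 fun _ _ => norm_nonneg _
      · exact ht.2
      · exact h.integral_norm_coeff_mono le_rfl ht.1 ht.2
    calc ‖u t - u a - (t - a) * du a‖ ≤ (t - a) * (‖u m‖ * ∫ s in a..t, ‖p s‖) :=
          (h.mono_left ht).norm_sub_sub_mul_deriv_le ht.1 fun s hs =>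
            hmax (Icc_subset_Icc_right ht.2 hs)
      _ = ‖u m‖ * ((t - a) * ∫ s in a..t, ‖p s‖) := by ring
      _ ≤ ‖u m‖ * (1 / 4) := by gcongr; exact hpt.trans hp
      _ = ‖u m‖ / 4 := by ring
  have hum : ‖u m‖ ≤ ‖u m‖ / 4 + ‖u a‖ + (b - a) * ‖du a‖ := by
    calc ‖u m‖ = ‖(u m - u a - (m - a) * du a) + u a + (m - a) * du a‖ := by congr 1; ring
      _ ≤ ‖u m - u a - (m - a) * du a‖ + ‖u a‖ + ‖((m : ℂ) - a) * du a‖ := norm_add₃_le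
      _ ≤ ‖u m‖ / 4 + ‖u a‖ + (b - a) * ‖du a‖ := by
        rw [norm_mul, ← Complex.ofReal_sub, Complex.norm_of_nonneg (sub_nonneg.2 hm.1)]
        gcongr
        · exact_mod_cast hquarter m hm
        · exact hm.2
  linarith [hquarter t ht]

theorem le_norm_of_half_le (h : IsSolutionOn p u du a b) (hab : a ≤ b)
    (hp : (b - a) * ∫ t in a..b, ‖p t‖ ≤ 1 / 4) {t : ℝ} (ht : t ∈ Icc ((a + b) / 2) b) :
    (b - a) * ‖du a‖ / 6 - 4 * ‖u a‖ / 3 ≤ ‖u t‖ := by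
  have ht' : t ∈ Icc a b := ⟨by linarith [ht.1], ht.2⟩
  have hlinear : (b - a) / 2 * ‖du a‖ ≤ ‖((t : ℂ) - a) * du a‖ := by
    rw [norm_mul, ← Complex.ofReal_sub, Complex.norm_of_nonneg (sub_nonneg.2 ht'.1)]
    gcongr
    linarith [ht.1]
  have htriangle : ‖((t : ℂ) - a) * du a‖ ≤ ‖u t‖ + ‖u a‖ + ‖u t - u a - (t - a) * du a‖ := by
    calc ‖((t : ℂ) - a) * du a‖ = ‖u t - u a - (u t - u a - (t - a) * du a)‖ := by congr 1; ring
      _ ≤ _ := (norm_sub_le _ _).trans (by gcongr; exact norm_sub_le _ _)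
  linarith [h.norm_sub_sub_mul_deriv_le_third hab hp ht']

theorem mul_sq_le_norm_mul_norm_deriv (h : IsSolutionOn p u du a b) (hab : a ≤ b) (hθ : 0 ≤ θ)
    (hp : ∀ t ∈ Icc a b, (p t).im ≤ -θ) (hflux : 0 ≤ flux u du b) (hL : 0 ≤ L)
    (hu : ∀ t ∈ Icc ((a + b) / 2) b, L ≤ ‖u t‖) :
    θ * L ^ 2 * ((b - a) / 2) ≤ ‖u a‖ * ‖du a‖ := by
  have hmid : (a + b) / 2 ∈ Icc a b := ⟨by linarith, by linarith⟩
  have hleft := h.mono_left hmid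
  have hright := h.mono_right hmid
  calc θ * L ^ 2 * ((b - a) / 2) = -∫ _ in ((a + b) / 2)..b, -θ * L ^ 2 := by
        rw [intervalIntegral.integral_const, smul_eq_mul]; ring
    _ ≤ -∫ t in ((a + b) / 2)..b, (p t).im * ‖u t‖ ^ 2 := by
        refine neg_le_neg (intervalIntegral.integral_mono_on hmid.2
          hright.hasACDeriv_flux.integrable intervalIntegrable_const fun t ht => ?_)
        have him := hp t ⟨hmid.1.trans ht.1, ht.2⟩
        have hsq : L ^ 2 ≤ ‖u t‖ ^ 2 := by gcongr; exact hu t ht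
        nlinarith [sq_nonneg ‖u t‖]
    _ ≤ flux u du ((a + b) / 2) := by
        rw [hright.integral_im_mul_norm_sq]
        linarith
    _ ≤ flux u du a := hleft.flux_le hmid.1 fun t ht =>
        (hp t ⟨ht.1, ht.2.trans hmid.2⟩).trans (neg_nonpos.2 hθ)
    _ ≤ ‖u a‖ * ‖du a‖ := flux_le_norm_mul_norm u du a

theorem norm_deriv_le (h : IsSolutionOn p u du a b) (hab : a < b) (hθ : 0 < θ)
    (hp : (b - a) * ∫ t in a..b, ‖p t‖ ≤ 1 / 4) (him : ∀ t ∈ Icc a b, (p t).im ≤ -θ)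
    (hflux : 0 ≤ flux u du b) :
    ‖du a‖ ≤ (16 / (b - a) + 288 / (θ * (b - a) ^ 3)) * ‖u a‖ := by
  set s := b - a with hs
  have hs₀ : 0 < s := sub_pos.2 hab
  by_cases hsmall : s * ‖du a‖ ≤ 16 * ‖u a‖
  · calc ‖du a‖ ≤ 16 / s * ‖u a‖ := by rw [div_mul_eq_mul_div, le_div_iff₀ hs₀]; linarith
      _ ≤ _ := by gcongr; exact le_add_of_nonneg_right (by positivity)
  · have hlower : ∀ t ∈ Icc ((a + b) / 2) b, s * ‖du a‖ / 12 ≤ ‖u t‖ := fun t ht => by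
      linarith [h.le_norm_of_half_le hab.le hp ht]
    have hmass := h.mul_sq_le_norm_mul_norm_deriv hab.le hθ.le him hflux (by positivity) hlower
    have hdu : 0 < ‖du a‖ := by
      by_contra! hdu
      nlinarith [norm_nonneg (u a)]
    rw [← hs] at hmass
    have hcube : θ * s ^ 3 * ‖du a‖ ≤ 288 * ‖u a‖ := by
      refine le_of_mul_le_mul_right ?_ hdu
      linarith
    calc ‖du a‖ ≤ 288 / (θ * s ^ 3) * ‖u a‖ := by
          rw [div_mul_eq_mul_div, le_div_iff₀ (by positivity)]; linarith
      _ ≤ _ := by gcongr; exact le_add_of_nonneg_left (by positivity)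

end IsSolutionOn

theorem exists_norm_deriv_le (N : ℝ) {δ θ : ℝ} (hδ : 0 < δ) (hθ : 0 < θ) :
    ∃ C, ∀ (p u du : ℝ → ℂ) (a : ℝ), IsSolutionOn p u du a (a + δ) →
      (∀ t ∈ Icc a (a + δ), (p t).im ≤ -θ) → ∫ t in a..(a + δ), ‖p t‖ ≤ N →
      0 ≤ flux u du (a + δ) → ‖du a‖ ≤ C * ‖u a‖ := by
  set s := min δ (1 / (4 * (|N| + 1)))
  have hs₀ : 0 < s := lt_min hδ (by positivity)
  refine ⟨16 / s + 288 / (θ * s ^ 3), fun p u du a h him hN hflux => ?_⟩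
  have hsδ : s ≤ δ := min_le_left _ _
  have hmem : a + s ∈ Icc a (a + δ) := ⟨by linarith, by linarith⟩
  have hleft := h.mono_left hmem
  have hright := h.mono_right hmem
  have hsN : s * ∫ t in a..(a + s), ‖p t‖ ≤ 1 / 4 := by
    calc s * ∫ t in a..(a + s), ‖p t‖ ≤ 1 / (4 * (|N| + 1)) * (|N| + 1) := by
          gcongr
          · exact intervalIntegral.integral_nonneg hmem.1 fun _ _ => norm_nonneg _
          · exact min_le_right _ _
          · linarith [le_abs_self N, h.integral_norm_coeff_mono le_rfl hmem.1 hmem.2]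
      _ = 1 / 4 := by field_simp
  have hflux' : 0 ≤ flux u du (a + s) := hflux.trans (hright.flux_le hmem.2 fun t ht =>
    (him t ⟨hmem.1.trans ht.1, ht.2⟩).trans (neg_nonpos.2 hθ.le))
  simpa using hleft.norm_deriv_le (lt_add_of_pos_right a hs₀) hθ (by simpa using hsN)
    (fun t ht => him t ⟨ht.1, ht.2.trans hmem.2⟩) hflux'

/-! ### Solutions up to the right endpoint -/

/-- `u` solves `-u'' + q u = z u` on `[0, c]` for every finite `c ≤ b`. Unlike in
`IsSchrodingerSolution`, a finite endpoint `b` is included. -/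
def SolvesUpTo (q : ℝ → ℝ) (b : EReal) (z : ℂ) (u du : ℝ → ℂ) : Prop :=
  ∀ c : ℝ, 0 ≤ c → (c : EReal) ≤ b → IsSolutionOn (fun t => (q t : ℂ) - z) u du 0 c

theorem intervalIntegrable_ofReal_sub {q : ℝ → ℝ} {a b : ℝ} (hq : IntervalIntegrable q volume a b)
    (z : ℂ) : IntervalIntegrable (fun t => (q t : ℂ) - z) volume a b :=
  IntervalIntegrable.sub ⟨hq.1.ofReal, hq.2.ofReal⟩ intervalIntegrable_const

theorem exists_solvesUpTo (q : ℝ → ℝ) (z α β : ℂ) :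
    ∃ u du : ℝ → ℂ, u 0 = α ∧ du 0 = β ∧
      ∀ b : EReal, (∀ c : ℝ, 0 ≤ c → (c : EReal) ≤ b → IntervalIntegrable q volume 0 c) →
        SolvesUpTo q b z u du := by
  obtain ⟨u, du, hu₀, hdu₀, hu⟩ := exists_isSolutionOn (fun t => (q t : ℂ) - z) 0 α β
  exact ⟨u, du, hu₀, hdu₀, fun b hq c hc hcb =>
    hu c hc (intervalIntegrable_ofReal_sub (hq c hc hcb) z)⟩

namespace IsSchrodingerSolution

variable {q : ℝ → ℝ} {b : EReal} {z : ℂ} {u du : ℝ → ℂ}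

theorem isSolutionOn (h : IsSchrodingerSolution q b z u du) {c : ℝ} (hc : 0 ≤ c)
    (hcb : (c : EReal) < b) (hq : IntervalIntegrable q volume 0 c) :
    IsSolutionOn (fun t => (q t : ℂ) - z) u du 0 c := by
  have hlt : ∀ x ∈ uIcc 0 c, 0 ≤ x ∧ (x : EReal) < b := fun x hx => by
    rw [uIcc_of_le hc] at hx
    exact ⟨hx.1, (EReal.coe_le_coe_iff.2 hx.2).trans_lt hcb⟩
  have hderiv : ∀ x ∈ uIcc 0 c, HasDerivWithinAt u (du x) (Ici 0) x := fun x hx =>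
    h.hasDeriv x (hlt x hx).1 (hlt x hx).2
  have hu : ContinuousOn u (uIcc 0 c) := fun x hx =>
    (hderiv x hx).continuousWithinAt.mono fun y hy => (hlt y hy).1
  have hp := intervalIntegrable_ofReal_sub hq z
  have hdu : HasACDeriv du (fun t => ((q t : ℂ) - z) * u t) 0 c :=
    .of_eq_integral (hp.mul_continuousOn hu) fun x hx => h.equation x (hlt x hx).1 (hlt x hx).2
  refine ⟨hp, .of_eq_integral hdu.continuousOn.intervalIntegrable fun x hx => ?_, hdu⟩
  have hsub : uIcc 0 x ⊆ uIcc 0 c := uIcc_subset_uIcc_left hx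
  rw [intervalIntegral.integral_eq_sub_of_hasDeriv_right (hu.mono hsub) (fun t ht => ?_)
    (hdu.continuousOn.mono hsub).intervalIntegrable, add_sub_cancel]
  rw [min_eq_left (hlt x hx).1] at ht
  exact (hderiv t (hsub (Ioo_subset_Icc_self.trans Icc_subset_uIcc
    ⟨ht.1, ht.2.trans_eq (max_eq_right (hlt x hx).1)⟩))).mono
    fun y hy => ht.1.le.trans (le_of_lt hy)

theorem exists_extension (h : IsSchrodingerSolution q b z u du)
    (hq : ∀ c : ℝ, 0 ≤ c → (c : EReal) ≤ b → IntervalIntegrable q volume 0 c) :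
    ∃ U dU : ℝ → ℂ, SolvesUpTo q b z U dU ∧
      ∀ x : ℝ, 0 ≤ x → (x : EReal) < b → U x = u x ∧ dU x = du x := by
  obtain ⟨U, dU, hU₀, hdU₀, hU⟩ := exists_solvesUpTo q z (u 0) (du 0)
  refine ⟨U, dU, hU b hq, fun x hx hxb => ?_⟩
  obtain ⟨hUu, hdUdu⟩ := (hU b hq x hx hxb.le).eqOn (h.isSolutionOn hx hxb (hq x hx hxb.le))
    (left_mem_Icc.2 hx) hU₀ hdU₀
  exact ⟨hUu (right_mem_Icc.2 hx), hdUdu (right_mem_Icc.2 hx)⟩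

theorem solvesUpTo (h : IsSchrodingerSolution q ⊤ z u du)
    (hq : ∀ c : ℝ, 0 ≤ c → IntervalIntegrable q volume 0 c) : SolvesUpTo q ⊤ z u du :=
  fun c hc _ => h.isSolutionOn hc (EReal.coe_lt_top c) (hq c hc)

end IsSchrodingerSolution

namespace SolvesUpTo

variable {q : ℝ → ℝ} {b : EReal} {z : ℂ} {u du : ℝ → ℂ}

theorem conj (h : SolvesUpTo q b z u du) :
    SolvesUpTo q b (star z) (fun t => star (u t)) (fun t => star (du t)) := fun c hc hcb => by
  simpa using (h c hc hcb).conj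

theorem isSchrodingerSolution (h : SolvesUpTo q ⊤ z u du) : IsSchrodingerSolution q ⊤ z u du := by
  have hdu : Continuous fun t : ℝ => du (max 0 t) :=
    ContinuousOn.comp_continuous (s := Ici 0) (fun x hx =>
      (((h (x + 1) (by linarith [mem_Ici.1 hx]) le_top).hasACDeriv_deriv.continuousOn x
        (Icc_subset_uIcc ⟨hx, by linarith⟩)).mono_of_mem_nhdsWithin
        (mem_of_superset (inter_mem_nhdsWithin (Ici 0) (Iic_mem_nhds (lt_add_one x)))
          Icc_subset_uIcc))) (continuous_const.max continuous_id) fun t => le_max_left 0 t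
  refine ⟨fun x hx _ => ?_, fun x hx _ => ?_⟩
  · have hu : ∀ y ∈ Ici (0 : ℝ), u y = u 0 + ∫ t in 0..y, du (max 0 t) := fun y hy => by
      rw [intervalIntegral.integral_congr (g := du) fun t ht => ?_,
        (h y hy le_top).hasACDeriv.integral_eq, add_sub_cancel]
      rw [uIcc_of_le hy] at ht
      simp only [max_eq_right ht.1]
    have hprim := ((hdu.integral_hasStrictDerivAt 0 x).hasDerivAt.const_add (u 0)).hasDerivWithinAt
      (s := Ici 0)
    rw [max_eq_right hx] at hprim
    exact hprim.congr hu (hu x hx)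
  · rw [(h x hx le_top).hasACDeriv_deriv.integral_eq, add_sub_cancel]

end SolvesUpTo

namespace RightEnd.Admissible

theorem intervalIntegrable {q : ℝ → ℝ} {B : RightEnd} (hB : B.Admissible q) {c : ℝ} (hc : 0 ≤ c)
    (hcB : (c : EReal) ≤ B.point) : IntervalIntegrable q volume 0 c := by
  rw [intervalIntegrable_iff_integrableOn_Ioo_of_le hc]
  cases B with
  | robin b h =>
    exact IntegrableOn.mono_set hB (Ioo_subset_Ioo_right (EReal.coe_le_coe_iff.1 hcB))
  | dirichlet b =>
    exact IntegrableOn.mono_set hB (Ioo_subset_Ioo_right (EReal.coe_le_coe_iff.1 hcB))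
  | limitPoint => exact hB.1 c
  | limitCircle u₀ du₀ => exact hB.1 c

end RightEnd.Admissible

/-! ### Weyl disks and the limit point case -/

theorem flux_of_eq_zero {u : ℝ → ℂ} (du : ℝ → ℂ) {x : ℝ} (hx : u x = 0) : flux u du x = 0 := by
  simp [flux, hx]

theorem flux_const_mul (c : ℂ) (u du : ℝ → ℂ) (x : ℝ) :
    flux (fun t => c * u t) (fun t => c * du t) x = ‖c‖ ^ 2 * flux u du x := by
  simp only [flux, star_mul', Complex.star_def, ← Complex.normSq_eq_norm_sq,
    ← Complex.im_ofReal_mul, Complex.normSq_eq_conj_mul_self]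
  ring_nf

namespace SolvesUpTo

variable {q : ℝ → ℝ} {b : EReal} {z : ℂ} {u du v dv : ℝ → ℂ} {x y : ℝ}

theorem add_const_mul (hu : SolvesUpTo q b z u du) (hv : SolvesUpTo q b z v dv) (k : ℂ) :
    SolvesUpTo q b z (fun t => u t + k * v t) (fun t => du t + k * dv t) :=
  fun c hc hcb => (hu c hc hcb).add_const_mul (hv c hc hcb) k

theorem flux_le (h : SolvesUpTo q b z u du) (hz : 0 ≤ z.im) (hx : 0 ≤ x) (hxy : x ≤ y)
    (hyb : (y : EReal) ≤ b) : flux u du y ≤ flux u du x :=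
  ((h y (hx.trans hxy) hyb).mono_right ⟨hx, hxy⟩).flux_le hxy fun t _ => by simpa using hz

theorem deriv_eq_zero (h : SolvesUpTo q b z u du) (hz : 0 < z.im) (hx : 0 ≤ x) (hxy : x < y)
    (hyb : (y : EReal) ≤ b) (hu : u x = 0) (hflux : 0 ≤ flux u du y) : du x = 0 := by
  obtain ⟨C, hC⟩ := exists_norm_deriv_le (∫ t in x..y, ‖(q t : ℂ) - z‖) (sub_pos.2 hxy) hz
  have hsol := (h y (hx.trans hxy.le) hyb).mono_right ⟨hx, hxy.le⟩
  refine norm_le_zero_iff.1 ?_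
  simpa [hu] using hC _ u du x (by rwa [add_sub_cancel]) (fun t _ => by simp) (by simp)
    (by rwa [add_sub_cancel])

theorem ne_zero (h : SolvesUpTo q b z u du) (hz : 0 < z.im) (hne : IsNontrivialOn b u) (hx : 0 ≤ x)
    (hxy : x < y) (hyb : (y : EReal) ≤ b) (hflux : 0 ≤ flux u du y) : u x ≠ 0 := fun hux => by
  obtain ⟨t, ht, htb, hut⟩ := hne
  have hsol : IsSolutionOn _ u du 0 (max x t) := h _ (le_max_of_le_left hx) <| by
    rcases max_cases x t with hmax | hmax <;> rw [hmax.1]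
    exacts [(EReal.coe_le_coe_iff.2 hxy.le).trans hyb, htb.le]
  exact hut (hsol.eq_zero ⟨hx, le_max_left x t⟩ hux (h.deriv_eq_zero hz hx hxy hyb hux hflux)
    ⟨ht, le_max_right x t⟩).1

theorem isSquareIntegrable (h : SolvesUpTo q ⊤ z u du) (hz : 0 < z.im)
    (hflux : ∀ y, 0 ≤ y → 0 ≤ flux u du y) : IsSquareIntegrable u := by
  refine integrableOn_Ioi_of_intervalIntegral_norm_bounded (ι := ℝ) (l := atTop) (b := id)
    (flux u du 0 / z.im) 0 (fun y => ?_) tendsto_id ?_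
  · rcases le_total 0 y with hy | hy
    · exact (h y hy le_top).hasACDeriv.continuousOn.norm.pow 2 |>.intervalIntegrable.1
    · simp [hy]
  · filter_upwards [eventually_ge_atTop 0] with y hy
    have hbalance := (h y hy le_top).integral_im_mul_norm_sq
    simp only [Complex.sub_im, Complex.ofReal_im, zero_sub,
      intervalIntegral.integral_const_mul] at hbalance
    simp only [id, norm_pow, norm_norm]
    rw [le_div_iff₀ hz]
    linarith [hflux y hy]

end SolvesUpTo

/-- The Weyl disk at `y`: the parameters `m` for which the current of `θ + m φ` at `y` is
nonnegative. It is a disk in the usual sense when `θ, φ` are the solutions with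
`θ 0 = φ' 0 = 1` and `θ' 0 = φ 0 = 0` for a spectral parameter in the upper half-plane. -/
def weylDisk (θ dθ φ dφ : ℝ → ℂ) (y : ℝ) : Set ℂ :=
  {m | 0 ≤ flux (fun t => θ t + m * φ t) (fun t => dθ t + m * dφ t) y}

theorem isClosed_weylDisk (θ dθ φ dφ : ℝ → ℂ) (y : ℝ) : IsClosed (weylDisk θ dθ φ dφ y) := by
  refine isClosed_le continuous_const ?_
  unfold flux
  fun_prop

section WeylDisk

variable {q : ℝ → ℝ} {z : ℂ} {θ dθ φ dφ : ℝ → ℂ}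

theorem weylDisk_anti (hθ : SolvesUpTo q ⊤ z θ dθ) (hφ : SolvesUpTo q ⊤ z φ dφ) (hz : 0 ≤ z.im)
    {x y : ℝ} (hx : 0 ≤ x) (hxy : x ≤ y) : weylDisk θ dθ φ dφ y ⊆ weylDisk θ dθ φ dφ x :=
  fun m hm => le_trans hm ((hθ.add_const_mul hφ m).flux_le hz hx hxy le_top)

theorem weylDisk_nonempty {b : EReal} (hφ : SolvesUpTo q b z φ dφ) (hz : 0 < z.im) (hφ₀ : φ 0 = 0)
    (hdφ₀ : dφ 0 ≠ 0) {y : ℝ} (hy : 0 < y) (hyb : (y : EReal) ≤ b) :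
    (weylDisk θ dθ φ dφ y).Nonempty := by
  have hφy : φ y ≠ 0 := fun hφy =>
    hdφ₀ (hφ.deriv_eq_zero hz le_rfl hy hyb hφ₀ (flux_of_eq_zero dφ hφy).ge)
  exact ⟨-θ y / φ y, (flux_of_eq_zero _ (by field_simp; ring)).ge⟩

theorem exists_weylDisk_subset_closedBall (hθ : SolvesUpTo q ⊤ z θ dθ) (hφ : SolvesUpTo q ⊤ z φ dφ)
    (hz : 0 < z.im) (hθ₀ : θ 0 = 1) (hdθ₀ : dθ 0 = 0) (hφ₀ : φ 0 = 0) (hdφ₀ : dφ 0 = 1) :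
    ∃ C, weylDisk θ dθ φ dφ 1 ⊆ Metric.closedBall 0 C := by
  obtain ⟨C, hC⟩ := exists_norm_deriv_le (∫ t in (0 : ℝ)..1, ‖(q t : ℂ) - z‖) one_pos hz
  refine ⟨C, fun m hm => ?_⟩
  have hbound : ‖dθ 0 + m * dφ 0‖ ≤ C * ‖θ 0 + m * φ 0‖ :=
    hC (fun t => (q t : ℂ) - z) (fun t => θ t + m * φ t) (fun t => dθ t + m * dφ t) 0
      (by simpa using hθ.add_const_mul hφ m 1 zero_le_one le_top) (fun t _ => by simp) (by simp)
      (by rwa [zero_add])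
  simpa [hθ₀, hdθ₀, hφ₀, hdφ₀] using hbound

end WeylDisk

theorem exists_flux_nonneg {q : ℝ → ℝ} (hq : ∀ c : ℝ, 0 ≤ c → IntervalIntegrable q volume 0 c)
    {z : ℂ} (hz : 0 < z.im) : ∃ v dv : ℝ → ℂ, SolvesUpTo q ⊤ z v dv ∧ v 0 = 1 ∧
      ∀ y, 0 ≤ y → 0 ≤ flux v dv y := by
  obtain ⟨θ, dθ, hθ₀, hdθ₀, hθ⟩ := exists_solvesUpTo q z 1 0
  obtain ⟨φ, dφ, hφ₀, hdφ₀, hφ⟩ := exists_solvesUpTo q z 0 1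
  have hθ := hθ ⊤ fun c hc _ => hq c hc
  have hφ := hφ ⊤ fun c hc _ => hq c hc
  obtain ⟨C, hC⟩ := exists_weylDisk_subset_closedBall hθ hφ hz hθ₀ hdθ₀ hφ₀ hdφ₀
  obtain ⟨m, hm⟩ : (⋂ n : ℕ, weylDisk θ dθ φ dφ (n + 1)).Nonempty := by
    refine IsCompact.nonempty_iInter_of_sequence_nonempty_isCompact_isClosed _ (fun n => ?_)
      (fun n => ?_) ?_ fun n => isClosed_weylDisk _ _ _ _ _
    · exact weylDisk_anti hθ hφ hz.le (by positivity) (by push_cast; linarith)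
    · exact weylDisk_nonempty hφ hz hφ₀ (by simp [hdφ₀]) (by positivity) le_top
    · refine (isCompact_closedBall (0 : ℂ) C).of_isClosed_subset (isClosed_weylDisk _ _ _ _ _) ?_
      simpa using hC
  refine ⟨_, _, hθ.add_const_mul hφ m, by simp [hθ₀, hφ₀], fun y hy => ?_⟩
  obtain ⟨n, hn⟩ := exists_nat_ge y
  exact weylDisk_anti hθ hφ hz.le hy (by linarith) (mem_iInter.1 hm n)

theorem IsLimitPoint.flux_nonneg {q : ℝ → ℝ} (hlp : IsLimitPoint q)
    (hq : ∀ c : ℝ, 0 ≤ c → IntervalIntegrable q volume 0 c) {z : ℂ} (hz : 0 < z.im)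
    {u du : ℝ → ℂ} (h : IsSchrodingerSolution q ⊤ z u du) (hu : IsSquareIntegrable u)
    {y : ℝ} (hy : 0 ≤ y) : 0 ≤ flux u du y := by
  obtain ⟨v, dv, hv, hv₀, hflux⟩ := exists_flux_nonneg hq hz
  have hv' := hv.isSchrodingerSolution
  obtain ⟨w, dw, -, -, -, hunique⟩ := hlp z hz
  obtain ⟨c, hc⟩ := hunique u du h hu
  obtain ⟨k, hk⟩ := hunique v dv hv' (hv.isSquareIntegrable hz hflux)
  have hkw : k * w 0 = 1 := by rw [← hk 0 le_rfl, hv₀]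
  have huv : ∀ x ∈ Ici (0 : ℝ), u x = c * w 0 * v x := fun x hx => by
    rw [hc x hx, hk x hx]
    linear_combination -c * w x * hkw
  have hduv : du y = c * w 0 * dv y :=
    (uniqueDiffOn_Ici (0 : ℝ) y hy).eq_deriv _ (h.hasDeriv y hy (EReal.coe_lt_top y))
      (((hv'.hasDeriv y hy (EReal.coe_lt_top y)).const_mul _).congr huv (huv y hy))
  have hscale : flux u du y = ‖c * w 0‖ ^ 2 * flux v dv y := by
    rw [← flux_const_mul]
    simp only [flux, huv y hy, hduv]
  rw [hscale]
  exact mul_nonneg (sq_nonneg _) (hflux y hy)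

/-! ### The limit circle case and general boundary conditions -/

theorem wronskian_star (u du v dv : ℝ → ℂ) (x : ℝ) :
    wronskian (fun t => star (u t)) (fun t => star (du t)) (fun t => star (v t))
      (fun t => star (dv t)) x = star (wronskian u du v dv x) := by
  simp [wronskian]

theorem IsSquareIntegrable.conj {u : ℝ → ℂ} (hu : IsSquareIntegrable u) :
    IsSquareIntegrable fun t => star (u t) := by
  simpa only [IsSquareIntegrable, norm_star] using hu

namespace SolvesUpTo

variable {q : ℝ → ℝ} {b : EReal} {z w : ℂ} {u du v dv : ℝ → ℂ}

theorem isBoundedUnder_wronskian (hu : SolvesUpTo q ⊤ z u du) (hv : SolvesUpTo q ⊤ w v dv)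
    (hu2 : IsSquareIntegrable u) (hv2 : IsSquareIntegrable v) :
    IsBoundedUnder (· ≤ ·) atTop (norm ∘ wronskian u du v dv) := by
  have hint : IntegrableOn (fun t => ‖z - w‖ * (‖u t‖ ^ 2 + ‖v t‖ ^ 2)) (Ioi 0) :=
    (Integrable.add hu2 hv2).const_mul _
  refine isBoundedUnder_of_eventually_le (a := ‖wronskian u du v dv 0‖ +
    ∫ t in Ioi (0 : ℝ), ‖z - w‖ * (‖u t‖ ^ 2 + ‖v t‖ ^ 2)) ?_
  filter_upwards [eventually_ge_atTop 0] with y hy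
  refine (norm_le_norm_add_norm_sub' _ (wronskian u du v dv 0)).trans ?_
  rw [(hu y hy le_top).wronskian_sub_eq_integral (hv y hy le_top)]
  gcongr
  calc ‖∫ t in (0 : ℝ)..y, ((q t : ℂ) - w - (q t - z)) * (u t * v t)‖
      ≤ ∫ t in (0 : ℝ)..y, ‖z - w‖ * (‖u t‖ ^ 2 + ‖v t‖ ^ 2) := by
        refine intervalIntegral.norm_integral_le_of_norm_le hy (.of_forall fun t _ => ?_)
          ((intervalIntegrable_iff_integrableOn_Ioc_of_le hy).2
            (hint.mono_set Ioc_subset_Ioi_self))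
        rw [sub_sub_sub_cancel_left, norm_mul, norm_mul]
        gcongr
        nlinarith [sq_nonneg (‖u t‖ - ‖v t‖), sq_nonneg ‖u t‖, sq_nonneg ‖v t‖]
    _ ≤ ∫ t in Ioi (0 : ℝ), ‖z - w‖ * (‖u t‖ ^ 2 + ‖v t‖ ^ 2) := by
        rw [intervalIntegral.integral_of_le hy]
        exact setIntegral_mono_set hint (.of_forall fun t => by positivity)
          Ioc_subset_Ioi_self.eventuallyLE

theorem exists_wronskian_eq_one (h : SolvesUpTo q b z u du) (hne : IsNontrivialOn b u) :
    ∃ v dv : ℝ → ℂ, SolvesUpTo q b z v dv ∧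
      ∀ x : ℝ, 0 ≤ x → (x : EReal) ≤ b → wronskian u du v dv x = 1 := by
  let N : ℝ := Complex.normSq (u 0) + Complex.normSq (du 0)
  have hN : (N : ℂ) ≠ 0 := fun hN => by
    obtain ⟨hu₀, hdu₀⟩ := (add_eq_zero_iff_of_nonneg (Complex.normSq_nonneg _)
      (Complex.normSq_nonneg _)).1 (Complex.ofReal_eq_zero.1 hN)
    obtain ⟨x, hx, hxb, hux⟩ := hne
    exact hux ((h x hx hxb.le).eq_zero (left_mem_Icc.2 hx) (Complex.normSq_eq_zero.1 hu₀)
      (Complex.normSq_eq_zero.1 hdu₀) (right_mem_Icc.2 hx)).1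
  obtain ⟨v, dv, hv₀, hdv₀, hv⟩ :=
    exists_isSolutionOn (fun t => (q t : ℂ) - z) 0 (-star (du 0) / N) (star (u 0) / N)
  have hv : SolvesUpTo q b z v dv := fun c hc hcb => hv c hc (h c hc hcb).coeff
  refine ⟨v, dv, hv, fun x hx hxb => ?_⟩
  rw [(h x hx hxb).wronskian_eq (hv x hx hxb), wronskian, hv₀, hdv₀]
  field_simp
  simp only [N, Complex.ofReal_add, ← Complex.mul_conj, Complex.star_def]
  ring

end SolvesUpTo

theorem tendsto_wronskian_zero {u du v dv f df g dg : ℝ → ℂ} {l : Filter ℝ}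
    (huv : ∀ᶠ x in l, wronskian u du v dv x = 1)
    (huf : Tendsto (wronskian u du f df) l (𝓝 0)) (hug : Tendsto (wronskian u du g dg) l (𝓝 0))
    (hvf : IsBoundedUnder (· ≤ ·) l (norm ∘ wronskian v dv f df))
    (hvg : IsBoundedUnder (· ≤ ·) l (norm ∘ wronskian v dv g dg)) :
    Tendsto (wronskian f df g dg) l (𝓝 0) := by
  have hlim := (huf.zero_mul_isBoundedUnder_le hvg).sub (hug.zero_mul_isBoundedUnder_le hvf)
  rw [sub_zero] at hlim
  refine hlim.congr' ?_
  filter_upwards [huv] with x hx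
  -- the Plücker relation between the six Wronskians of four functions
  calc wronskian u du f df x * wronskian v dv g dg x - wronskian u du g dg x * wronskian v dv f df x
      = wronskian u du v dv x * wronskian f df g dg x := by simp only [wronskian]; ring
    _ = wronskian f df g dg x := by rw [hx, one_mul]

theorem IsLimitCircle.flux_nonneg {q : ℝ → ℝ} (hlc : IsLimitCircle q) {z : ℂ} (hz : 0 < z.im)
    {u du u₀ du₀ : ℝ → ℂ} (h : SolvesUpTo q ⊤ z u du) (h₀ : SolvesUpTo q ⊤ Complex.I u₀ du₀)
    (hne : IsNontrivialOn ⊤ u₀)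
    (hself : Tendsto (wronskian (fun t => star (u₀ t)) (fun t => star (du₀ t)) u₀ du₀) atTop (𝓝 0))
    (hbc : Tendsto (wronskian u₀ du₀ u du) atTop (𝓝 0)) {y : ℝ} (hy : 0 ≤ y) :
    0 ≤ flux u du y := by
  obtain ⟨v, dv, hv, huv⟩ := h₀.exists_wronskian_eq_one hne
  have huv : ∀ᶠ x in atTop, wronskian u₀ du₀ v dv x = 1 :=
    (eventually_ge_atTop 0).mono fun x hx => huv x hx le_top
  have hL {z : ℂ} (hz : 0 < z.im) {u du : ℝ → ℂ} (h : SolvesUpTo q ⊤ z u du) :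
      IsSquareIntegrable u := hlc z hz u du h.isSchrodingerSolution
  have hI : 0 < Complex.I.im := by simp
  have hbu := hv.isBoundedUnder_wronskian h (hL hI hv) (hL hz h)
  have hself' : Tendsto (wronskian u₀ du₀ (fun t => star (u₀ t)) fun t => star (du₀ t)) atTop
      (𝓝 0) := by
    have hneg := hself.neg
    rw [neg_zero] at hneg
    exact hneg.congr fun x => by simp only [wronskian]; ring
  have hmixed : Tendsto (wronskian (fun t => star (u₀ t)) (fun t => star (du₀ t)) u du) atTop
      (𝓝 0) :=
    tendsto_wronskian_zero huv hself' hbc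
      (hv.isBoundedUnder_wronskian h₀.conj (hL hI hv) (hL hI h₀).conj) hbu
  have hconj : Tendsto (wronskian u₀ du₀ (fun t => star (u t)) fun t => star (du t)) atTop
      (𝓝 0) := by
    simpa [← wronskian_star] using hmixed.star
  have hself_u := tendsto_wronskian_zero huv hconj hbc
    (hv.isBoundedUnder_wronskian h.conj (hL hI hv) (hL hz h).conj) hbu
  have hflux : Tendsto (flux u du) atTop (𝓝 0) := by
    have hre := (Complex.continuous_re.tendsto _).comp (hself_u.const_mul (2 * Complex.I)⁻¹)
    simpa only [Function.comp_def, wronskian_star_self, ne_eq, mul_eq_zero, OfNat.ofNat_ne_zero,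
      Complex.I_ne_zero, or_self, not_false_eq_true, inv_mul_cancel_left₀, mul_zero,
      Complex.ofReal_re, Complex.zero_re] using hre
  refine le_of_tendsto hflux ?_
  filter_upwards [eventually_ge_atTop y] with t ht using h.flux_le hz.le hy ht le_top

theorem RightEnd.Condition.congr {B : RightEnd} {u du U dU : ℝ → ℂ} (h : B.Condition u du)
    (hB : 0 < B.point) (hU : ∀ x : ℝ, 0 ≤ x → (x : EReal) < B.point → U x = u x ∧ dU x = du x) :
    B.Condition U dU := by
  cases B with
  | robin b r =>
    refine Tendsto.congr' ?_ h
    filter_upwards [Ioo_mem_nhdsLT (EReal.coe_lt_coe_iff.1 hB)] with x hx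
    obtain ⟨hUx, hdUx⟩ := hU x hx.1.le (EReal.coe_lt_coe_iff.2 hx.2)
    rw [hUx, hdUx]
  | dirichlet b =>
    refine Tendsto.congr' ?_ h
    filter_upwards [Ioo_mem_nhdsLT (EReal.coe_lt_coe_iff.1 hB)] with x hx
    exact (hU x hx.1.le (EReal.coe_lt_coe_iff.2 hx.2)).1.symm
  | limitPoint =>
    exact IntegrableOn.congr_fun h (fun x hx => by
      rw [(hU x (le_of_lt hx) (EReal.coe_lt_top x)).1]) measurableSet_Ioi
  | limitCircle u₀ du₀ =>
    refine Tendsto.congr' ?_ h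
    filter_upwards [eventually_ge_atTop 0] with x hx
    obtain ⟨hUx, hdUx⟩ := hU x hx (EReal.coe_lt_top x)
    rw [hUx, hdUx]

namespace SolvesUpTo

variable {q : ℝ → ℝ} {z : ℂ} {u du : ℝ → ℂ}

theorem tendsto_left {b : ℝ} (h : SolvesUpTo q b z u du) (hb : 0 < b) :
    Tendsto u (𝓝[<] b) (𝓝 (u b)) ∧ Tendsto du (𝓝[<] b) (𝓝 (du b)) := by
  have hsol := h b hb.le le_rfl
  have hnhds : uIcc 0 b ∈ 𝓝[<] b := by
    rw [uIcc_of_le hb.le]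
    exact Icc_mem_nhdsLT hb
  have hmem : b ∈ uIcc 0 b := right_mem_uIcc
  exact ⟨(hsol.hasACDeriv.continuousOn b hmem).mono_of_mem_nhdsWithin hnhds,
    (hsol.hasACDeriv_deriv.continuousOn b hmem).mono_of_mem_nhdsWithin hnhds⟩

theorem flux_nonneg {B : RightEnd} (h : SolvesUpTo q B.point z u du) (hB : B.Admissible q)
    (hB₀ : 0 < B.point) (hz : 0 < z.im) (hcond : B.Condition u du) {y : ℝ} (hy : 0 ≤ y)
    (hyB : (y : EReal) ≤ B.point) : 0 ≤ flux u du y := by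
  have hq (c : ℝ) (hc : 0 ≤ c) : (c : EReal) ≤ B.point → IntervalIntegrable q volume 0 c :=
    hB.intervalIntegrable hc
  cases B with
  | robin b r =>
    obtain ⟨hu, hdu⟩ := h.tendsto_left (EReal.coe_lt_coe_iff.1 hB₀)
    have hbc : du b + r * u b = 0 := tendsto_nhds_unique (hdu.add (hu.const_mul _)) hcond
    have hflux : flux u du b = 0 := by
      rw [flux, eq_neg_of_add_eq_zero_left hbc]
      simp
      ring
    exact hflux ▸ h.flux_le hz.le hy (EReal.coe_le_coe_iff.1 hyB) le_rfl
  | dirichlet b =>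
    have hbc : u b = 0 :=
      tendsto_nhds_unique (h.tendsto_left (EReal.coe_lt_coe_iff.1 hB₀)).1 hcond
    exact flux_of_eq_zero du hbc ▸ h.flux_le hz.le hy (EReal.coe_le_coe_iff.1 hyB) le_rfl
  | limitPoint =>
    exact hB.2.flux_nonneg (fun c hc => hq c hc le_top) hz h.isSchrodingerSolution hcond hy
  | limitCircle u₀ du₀ =>
    obtain ⟨-, hlc, h₀, hne, hself⟩ := hB
    exact hlc.flux_nonneg hz h (h₀.solvesUpTo fun c hc => hq c hc le_top) hne hself hcond hy

end SolvesUpTo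

/-! ### The Cayley transform and large `|κ|` -/

theorem HasACDeriv.norm_left_le {F g : ℝ → ℂ} {a b : ℝ} {k : ℂ} {φ : ℝ → ℝ}
    (hF : HasACDeriv F (fun t => k * F t + g t) a b) (hab : a ≤ b) (hk : 0 ≤ k.re)
    (hg : ∀ t ∈ Icc a b, ‖g t‖ ≤ φ t) (hφ : IntervalIntegrable φ volume a b) :
    ‖F a‖ ≤ Real.exp (-(k.re * (b - a))) * ‖F b‖ + ∫ t in a..b, φ t := by
  have hexp : HasACDeriv (fun t : ℝ => Complex.exp (-k * (t - a)))
      (fun t => Complex.exp (-k * (t - a)) * -k) a b :=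
    .of_hasDerivAt (fun t => by
      simpa using
        ((Complex.ofRealCLM.hasDerivAt (x := t)).sub_const (a : ℂ)).const_mul (-k) |>.cexp)
      (by fun_prop)
  have hnorm (t : ℝ) : ‖Complex.exp (-k * (t - a))‖ = Real.exp (-(k.re * (t - a))) := by
    simp [Complex.norm_exp]
  have hprod := ((hexp.mul hF).congr_deriv
    (g := fun t : ℝ => Complex.exp (-k * (t - a)) * g t) fun t _ => by ring).integral_eq
  rw [sub_self, mul_zero, Complex.exp_zero, one_mul] at hprod
  rw [← hnorm, ← norm_mul, ← sub_sub_cancel (_ * F b) (F a), ← hprod]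
  refine (norm_sub_le _ _).trans (add_le_add_right ?_ _)
  refine intervalIntegral.norm_integral_le_of_norm_le hab (.of_forall fun t ht => ?_) hφ
  rw [norm_mul, hnorm]
  exact (mul_le_of_le_one_left (norm_nonneg _) (Real.exp_le_one_iff.2
    (neg_nonpos.2 (mul_nonneg hk (sub_nonneg.2 ht.1.le))))).trans (hg t (Ioc_subset_Icc_self ht))

theorem neg_im_mul_norm_le {κ : ℂ} {u du : ℝ → ℂ} {x : ℝ} (h : 0 ≤ flux u du x) :
    -κ.im * ‖u x‖ ≤ ‖du x - κ * u x‖ := by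
  rcases eq_or_ne (u x) 0 with hux | hux
  · simp [hux]
  refine le_of_mul_le_mul_left ?_ (norm_pos_iff.2 hux)
  calc ‖u x‖ * (-κ.im * ‖u x‖) = -κ.im * Complex.normSq (u x) := by
        rw [Complex.normSq_eq_norm_sq]
        ring
    _ ≤ flux u du x - κ.im * Complex.normSq (u x) := by linarith
    _ = (star (u x) * (du x - κ * u x)).im := by
        simp only [flux, Complex.normSq_apply, Complex.star_def, Complex.mul_im, Complex.sub_im,
          Complex.sub_re, Complex.mul_re, Complex.conj_re, Complex.conj_im]
        ring
    _ ≤ ‖u x‖ * ‖du x - κ * u x‖ := by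
        rw [← norm_star (u x), ← norm_mul]
        exact Complex.im_le_norm _

/-- The Cayley transform `(m + κ) / (m - κ)` of the logarithmic derivative `m = u' / u`. It vanishes
where `m = -κ`. -/
noncomputable def cayley (κ : ℂ) (u du : ℝ → ℂ) (x : ℝ) : ℂ :=
  (du x + κ * u x) / (du x - κ * u x)

section Cayley

variable {κ : ℂ} {p u du : ℝ → ℂ} {a b x σ : ℝ}

theorem cayley_sub_one (h : du x - κ * u x ≠ 0) :
    cayley κ u du x - 1 = 2 * κ * u x / (du x - κ * u x) := by
  rw [cayley, div_sub_one h]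
  ring

theorem norm_cayley_sub_one_le (hσ : 0 < σ) (hκσ : σ * ‖κ‖ ≤ -κ.im)
    (h : du x - κ * u x ≠ 0) (hflux : 0 ≤ flux u du x) : ‖cayley κ u du x - 1‖ ≤ 2 / σ := by
  rw [cayley_sub_one h, norm_div, norm_mul, norm_mul, Complex.norm_ofNat,
    div_le_div_iff₀ (norm_pos_iff.2 h) hσ]
  have hle : σ * ‖κ‖ * ‖u x‖ ≤ ‖du x - κ * u x‖ :=
    (mul_le_mul_of_nonneg_right hκσ (norm_nonneg _)).trans (neg_im_mul_norm_le hflux)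
  linarith

theorem norm_div_add_le (hu : u x ≠ 0) (h : du x - κ * u x ≠ 0) (hR : ‖cayley κ u du x‖ ≤ 1 / 2) :
    ‖du x / u x + κ‖ ≤ 4 * (‖κ‖ * ‖cayley κ u du x‖) := by
  have hmul : (du x / u x + κ) * (1 - cayley κ u du x) = -2 * κ * cayley κ u du x := by
    rw [← neg_sub, cayley_sub_one h, cayley]
    field_simp
  have hnorm := congrArg norm hmul
  rw [norm_mul, norm_mul, norm_mul, norm_neg, Complex.norm_ofNat] at hnorm
  have hhalf : 1 / 2 ≤ ‖1 - cayley κ u du x‖ := by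
    have hreverse := norm_sub_norm_le (1 : ℂ) (cayley κ u du x)
    rw [norm_one] at hreverse
    linarith
  linarith [mul_le_mul_of_nonneg_left hhalf (norm_nonneg (du x / u x + κ))]

namespace IsSolutionOn

theorem deriv_sub_const_mul_ne_zero (h : IsSolutionOn p u du a b) (hκ : κ.im < 0)
    (hflux : 0 ≤ flux u du x) (hx : x ∈ Icc a b) (hu : u a ≠ 0) : du x - κ * u x ≠ 0 := by
  intro hx₀
  have hle := neg_im_mul_norm_le (κ := κ) hflux
  rw [hx₀, norm_zero] at hle
  have hux : u x = 0 := norm_le_zero_iff.1 (nonpos_of_mul_nonpos_right hle (neg_pos.2 hκ))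
  exact hu (h.eq_zero hx hux (by simpa [hux] using hx₀)
    (left_mem_Icc.2 (hx.1.trans hx.2))).1

theorem hasACDeriv_cayley (h : IsSolutionOn p u du a b)
    (hne : ∀ x ∈ uIcc a b, du x - κ * u x ≠ 0) :
    HasACDeriv (cayley κ u du) (fun x => 2 * κ * cayley κ u du x +
      -((p x - κ ^ 2) * (cayley κ u du x - 1) ^ 2 / (2 * κ))) a b := by
  have hnum := h.hasACDeriv_deriv.add (h.hasACDeriv.const_mul κ)
  have hden := (h.hasACDeriv_deriv.add (h.hasACDeriv.const_mul (-κ))).congr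
    fun x _ => show _ = du x - κ * u x by ring
  refine (hnum.mul (hden.inv hne)).congr_deriv fun x hx => ?_
  have hx := hne x hx
  rw [cayley_sub_one hx, cayley]
  field_simp
  ring

theorem norm_cayley_le (h : IsSolutionOn p u du a b) (hab : a < b) (hσ : 0 < σ) (hκ : κ ≠ 0)
    (hre : σ * ‖κ‖ ≤ κ.re) (him : σ * ‖κ‖ ≤ -κ.im) (hu : u a ≠ 0)
    (hflux : ∀ t ∈ Icc a b, 0 ≤ flux u du t) :
    ‖cayley κ u du a‖ ≤ ((1 + 2 / σ) / (2 * σ * (b - a)) +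
      2 * (∫ t in a..b, ‖p t - κ ^ 2‖) / σ ^ 2) / ‖κ‖ := by
  have hκ₀ := norm_pos_iff.2 hκ
  have hσκ : 0 < σ * ‖κ‖ := mul_pos hσ hκ₀
  have hba := sub_pos.2 hab
  have hne (t : ℝ) (ht : t ∈ Icc a b) : du t - κ * u t ≠ 0 :=
    h.deriv_sub_const_mul_ne_zero (by linarith) (hflux t ht) ht hu
  have hsub (t : ℝ) (ht : t ∈ Icc a b) : ‖cayley κ u du t - 1‖ ≤ 2 / σ :=
    norm_cayley_sub_one_le hσ him (hne t ht) (hflux t ht)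
  have hexp : Real.exp (-((2 * κ).re * (b - a))) ≤ 1 / (2 * (σ * ‖κ‖) * (b - a)) := by
    rw [Real.exp_neg, ← one_div]
    gcongr
    refine le_trans ?_ ((Real.add_one_le_exp _).trans' (le_add_of_nonneg_right zero_le_one))
    gcongr
    simpa using hre
  have hend : ‖cayley κ u du b‖ ≤ 1 + 2 / σ := by
    simpa using (norm_le_norm_add_norm_sub' _ 1).trans
      (add_le_add_right (hsub b (right_mem_Icc.2 hab.le)) ‖(1 : ℂ)‖)
  have hint : IntervalIntegrable (fun t => ‖p t - κ ^ 2‖) volume a b :=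
    (h.coeff.sub intervalIntegrable_const).norm
  calc ‖cayley κ u du a‖
      ≤ Real.exp (-((2 * κ).re * (b - a))) * ‖cayley κ u du b‖ +
          ∫ t in a..b, ‖p t - κ ^ 2‖ * ((2 / σ) ^ 2 / (2 * ‖κ‖)) := by
        refine (h.hasACDeriv_cayley (by rwa [uIcc_of_le hab.le])).norm_left_le hab.le ?_
          (fun t ht => ?_) (hint.mul_const _)
        · simpa using hσκ.le.trans hre
        · rw [norm_neg, norm_div, norm_mul, norm_pow, norm_mul, Complex.norm_ofNat, mul_div_assoc]
          gcongr
          exact hsub t ht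
    _ ≤ 1 / (2 * (σ * ‖κ‖) * (b - a)) * (1 + 2 / σ) +
          (∫ t in a..b, ‖p t - κ ^ 2‖) * ((2 / σ) ^ 2 / (2 * ‖κ‖)) := by
        rw [intervalIntegral.integral_mul_const]
        gcongr
    _ = _ := by field_simp

end IsSolutionOn

end Cayley

theorem exists_norm_div_add_le_of_le_norm (N : ℝ) {δ σ : ℝ} (hδ : 0 < δ) (hσ : 0 < σ) :
    ∃ K C : ℝ, ∀ κ : ℂ, K ≤ ‖κ‖ → σ * ‖κ‖ ≤ κ.re → σ * ‖κ‖ ≤ -κ.im →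
      ∀ (p u du : ℝ → ℂ) (a : ℝ), IsSolutionOn p u du a (a + δ) → u a ≠ 0 →
        ∫ t in a..(a + δ), ‖p t - κ ^ 2‖ ≤ N →
        (∀ t ∈ Icc a (a + δ), 0 ≤ flux u du t) → ‖du a / u a + κ‖ ≤ C := by
  let C := (1 + 2 / σ) / (2 * σ * δ) + 2 * N / σ ^ 2
  refine ⟨max 1 (2 * C), 4 * C, fun κ hK hre him p u du a h hu hN hflux => ?_⟩
  have hκ : 0 < ‖κ‖ := one_pos.trans_le ((le_max_left _ _).trans hK)
  have hab : a < a + δ := lt_add_of_pos_right a hδ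
  have hR : ‖cayley κ u du a‖ ≤ C / ‖κ‖ := by
    refine (h.norm_cayley_le hab hσ (norm_pos_iff.1 hκ) hre him hu hflux).trans ?_
    simp only [add_sub_cancel_left, C]
    gcongr
  have hhalf : C / ‖κ‖ ≤ 1 / 2 := by
    rw [div_le_div_iff₀ hκ two_pos]
    linarith [(le_max_right 1 (2 * C)).trans hK]
  have hmem : a ∈ Icc a (a + δ) := left_mem_Icc.2 hab.le
  calc ‖du a / u a + κ‖ ≤ 4 * (‖κ‖ * ‖cayley κ u du a‖) :=
        norm_div_add_le hu (h.deriv_sub_const_mul_ne_zero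
          (by linarith [mul_pos hσ hκ]) (hflux a hmem) hmem hu) (hR.trans hhalf)
    _ ≤ 4 * C := by
        rw [le_div_iff₀ hκ, mul_comm] at hR
        gcongr

/-! ### Uniformity in the sector -/

namespace IsWeylSolution

variable {q : ℝ → ℝ} {B : RightEnd} {z : ℂ} {u du : ℝ → ℂ}

theorem exists_extension (h : IsWeylSolution q B z u du) (hB : B.Admissible q) (hz : 0 < z.im) :
    ∃ U dU : ℝ → ℂ, SolvesUpTo q B.point z U dU ∧
      (∀ x : ℝ, 0 ≤ x → (x : EReal) < B.point → U x = u x ∧ dU x = du x) ∧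
      ∀ y : ℝ, 0 ≤ y → (y : EReal) ≤ B.point → 0 ≤ flux U dU y := by
  obtain ⟨x, hx, hxB, -⟩ := h.nontrivial
  have hB₀ : 0 < B.point := (EReal.coe_le_coe_iff.2 hx).trans_lt hxB
  obtain ⟨U, dU, hU, hagree⟩ := h.solution.exists_extension fun c hc => hB.intervalIntegrable hc
  exact ⟨U, dU, hU, hagree, fun y => hU.flux_nonneg hB hB₀ hz (h.condition.congr hB₀ hagree)⟩

theorem ne_zero (h : IsWeylSolution q B z u du) (hB : B.Admissible q) (hz : 0 < z.im) {x : ℝ}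
    (hx : 0 ≤ x) (hxB : (x : EReal) < B.point) : u x ≠ 0 := by
  obtain ⟨U, dU, hU, hagree, hflux⟩ := h.exists_extension hB hz
  obtain ⟨t, ht, htB, hut⟩ := h.nontrivial
  obtain ⟨y, hxy, hyB⟩ := EReal.lt_iff_exists_real_btwn.1 hxB
  have hxy : x < y := EReal.coe_lt_coe_iff.1 hxy
  rw [← (hagree x hx hxB).1]
  exact hU.ne_zero hz ⟨t, ht, htB, (hagree t ht htB).1 ▸ hut⟩ hx hxy hyB.le
    (hflux y (hx.trans hxy.le) hyB.le)

end IsWeylSolution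

theorem exists_mul_norm_le_re_neg_im {ε : ℝ} (hε : 0 < ε) :
    ∃ σ : ℝ, 0 < σ ∧ ∀ κ : ℂ, κ.arg ∈ Ioo (-(Real.pi / 2) + ε) (-ε) →
      σ * ‖κ‖ ≤ κ.re ∧ σ * ‖κ‖ ≤ -κ.im := by
  have hpos : 0 < min ε 1 := lt_min hε one_pos
  have hε' : min ε 1 ≤ ε := min_le_left ε 1
  refine ⟨Real.sin (min ε 1), Real.sin_pos_of_pos_of_lt_pi hpos
    ((min_le_right ε 1).trans_lt (by linarith [Real.pi_gt_three])), fun κ hκ => ⟨?_, ?_⟩⟩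
  · rw [← Complex.norm_mul_cos_arg κ, mul_comm, ← Real.sin_add_pi_div_two]
    gcongr
    exact Real.sin_le_sin_of_le_of_le_pi_div_two (by linarith [Real.pi_pos])
      (by linarith [hκ.2]) (by linarith [hκ.1])
  · rw [← Complex.norm_mul_sin_arg κ, mul_comm, ← mul_neg, ← Real.sin_neg]
    gcongr
    exact Real.sin_le_sin_of_le_of_le_pi_div_two (by linarith [Real.pi_pos])
      (by linarith [hκ.1]) (by linarith [hκ.2])

theorem mul_sq_le_im_neg_sq {κ : ℂ} {c : ℝ} (hc : 0 ≤ c) (hre : c ≤ κ.re) (him : c ≤ -κ.im) :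
    2 * c ^ 2 ≤ (-κ ^ 2).im := by
  have hmul : c * c ≤ κ.re * -κ.im := mul_le_mul hre him hc (hc.trans hre)
  rw [Complex.neg_im, sq κ, Complex.mul_im]
  linarith

theorem exists_norm_div_add_le_of_norm_le (N K : ℝ) {δ θ : ℝ} (hδ : 0 < δ) (hθ : 0 < θ) :
    ∃ C : ℝ, ∀ κ : ℂ, ‖κ‖ ≤ K →
      ∀ (p u du : ℝ → ℂ) (a : ℝ), IsSolutionOn p u du a (a + δ) → u a ≠ 0 →
        (∀ t ∈ Icc a (a + δ), (p t).im ≤ -θ) → ∫ t in a..(a + δ), ‖p t - κ ^ 2‖ ≤ N →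
        0 ≤ flux u du (a + δ) → ‖du a / u a + κ‖ ≤ C := by
  obtain ⟨C, hC⟩ := exists_norm_deriv_le (N + δ * K ^ 2) hδ hθ
  refine ⟨C + K, fun κ hκ p u du a h hu hp hN hflux => ?_⟩
  have hsub : IntervalIntegrable (fun t => ‖p t - κ ^ 2‖) volume a (a + δ) :=
    (h.coeff.sub intervalIntegrable_const).norm
  have hmass : ∫ t in a..(a + δ), ‖p t‖ ≤ N + δ * K ^ 2 := by
    calc ∫ t in a..(a + δ), ‖p t‖ ≤ ∫ t in a..(a + δ), (‖p t - κ ^ 2‖ + ‖κ‖ ^ 2) :=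
          intervalIntegral.integral_mono_on (by linarith) h.coeff.norm
            (hsub.add intervalIntegrable_const) fun t _ => by
              rw [← norm_pow]
              exact norm_le_norm_sub_add _ _
      _ = (∫ t in a..(a + δ), ‖p t - κ ^ 2‖) + δ * ‖κ‖ ^ 2 := by
          rw [intervalIntegral.integral_add hsub intervalIntegrable_const,
            intervalIntegral.integral_const, add_sub_cancel_left, smul_eq_mul]
      _ ≤ N + δ * K ^ 2 := by gcongr
  refine (norm_add_le _ _).trans (add_le_add ?_ hκ)
  rw [norm_div, div_le_iff₀ (norm_pos_iff.2 hu)]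
  exact hC p u du a h hp hmass hflux

theorem exists_norm_div_add_le (η : ℝ) {δ σ K₀ : ℝ} (hδ : 0 < δ) (hσ : 0 < σ) (hK₀ : 0 < K₀) :
    ∃ C : ℝ, ∀ κ : ℂ, σ * ‖κ‖ ≤ κ.re → σ * ‖κ‖ ≤ -κ.im → K₀ ≤ ‖κ‖ →
      ∀ (q : ℝ → ℝ) (u du : ℝ → ℂ) (a : ℝ),
        IsSolutionOn (fun t => (q t : ℂ) - -κ ^ 2) u du a (a + δ) → u a ≠ 0 →
        ∫ t in a..(a + δ), |q t| ≤ η → (∀ t ∈ Icc a (a + δ), 0 ≤ flux u du t) →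
        ‖du a / u a + κ‖ ≤ C := by
  obtain ⟨K, C₁, hlarge⟩ := exists_norm_div_add_le_of_le_norm η hδ hσ
  obtain ⟨C₂, hsmall⟩ := exists_norm_div_add_le_of_norm_le η K hδ
    (θ := 2 * (σ * K₀) ^ 2) (by positivity)
  refine ⟨max C₁ C₂, fun κ hre him hκ q u du a h hu hη hflux => ?_⟩
  have hκσ : σ * K₀ ≤ σ * ‖κ‖ := mul_le_mul_of_nonneg_left hκ hσ.le
  have him_sq : 2 * (σ * K₀) ^ 2 ≤ (-κ ^ 2).im :=
    mul_sq_le_im_neg_sq (by positivity) (hκσ.trans hre) (hκσ.trans him)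
  have him_p (t : ℝ) (_ : t ∈ Icc a (a + δ)) :
      ((q t : ℂ) - -κ ^ 2).im ≤ -(2 * (σ * K₀) ^ 2) := by
    rw [Complex.sub_im, Complex.ofReal_im, zero_sub]
    exact neg_le_neg him_sq
  have hη : ∫ t in a..(a + δ), ‖(q t : ℂ) - -κ ^ 2 - κ ^ 2‖ ≤ η := by simpa using hη
  rcases le_total K ‖κ‖ with hK | hK
  · exact le_max_of_le_left (hlarge κ hK hre him _ u du a h hu hη hflux)
  · exact le_max_of_le_right (hsmall κ hK _ u du a h hu him_p hη
      (hflux _ (right_mem_Icc.2 (by linarith))))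

theorem theorem1p4 (ε δ K₀ η : ℝ) (hε : 0 < ε) (hδ : 0 < δ) (hK₀ : 0 < K₀) :
    ∃ C : ℝ, ∀ (a : ℝ) (q : ℝ → ℝ) (B : RightEnd),
      0 ≤ a → ((a + δ : ℝ) : EReal) ≤ B.point → B.Admissible q →
      (∀ x ∈ Set.Icc (0 : ℝ) a, (∫ y in x..(x + δ), |q y|) ≤ η) →
      ∀ κ : ℂ, κ.arg ∈ Set.Ioo (-(Real.pi / 2) + ε) (-ε) → K₀ ≤ ‖κ‖ →
      ∀ u du : ℝ → ℂ, IsWeylSolution q B (-κ ^ 2) u du →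
      ∀ x ∈ Set.Icc (0 : ℝ) a, u x ≠ 0 ∧ ‖du x / u x + κ‖ ≤ C := by
  obtain ⟨σ, hσ, hsector⟩ := exists_mul_norm_le_re_neg_im hε
  obtain ⟨C, hC⟩ := exists_norm_div_add_le η hδ hσ hK₀
  refine ⟨C, fun a q B _ haB hB hη κ hκ hκK₀ u du h x hx => ?_⟩
  obtain ⟨hre, him⟩ := hsector κ hκ
  have hκσ : 0 < σ * ‖κ‖ := mul_pos hσ (hK₀.trans_le hκK₀)
  have hz : 0 < (-κ ^ 2).im := (by positivity : (0 : ℝ) < _).trans_le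
    (mul_sq_le_im_neg_sq hκσ.le hre him)
  have hxδB : ((x + δ : ℝ) : EReal) ≤ B.point :=
    (EReal.coe_le_coe_iff.2 (add_le_add_left hx.2 δ)).trans haB
  have hxB : (x : EReal) < B.point :=
    (EReal.coe_lt_coe_iff.2 (lt_add_of_pos_right x hδ)).trans_le hxδB
  have hux : u x ≠ 0 := h.ne_zero hB hz hx.1 hxB
  obtain ⟨U, dU, hU, hagree, hflux⟩ := h.exists_extension hB hz
  obtain ⟨hUx, hdUx⟩ := hagree x hx.1 hxB
  have hsol := (hU (x + δ) (by linarith [hx.1]) hxδB).mono_right ⟨hx.1, by linarith⟩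
  refine ⟨hux, ?_⟩
  rw [← hUx, ← hdUx]
  exact hC κ hre him hκK₀ q U dU x hsol (hUx ▸ hux) (hη x hx) fun t ht =>
    hflux t (hx.1.trans ht.1) ((EReal.coe_le_coe_iff.2 ht.2).trans hxδB)
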